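/- Let $p>3$ be a prime and $\delta\ge 1$. Put $R=\mathbb Z/p^\delta$, $G=\mathrm{SL}_2(R)$, and let $G$ act on $R[X,Y]$ by $\begin{pmatrix}a&b\\c&d\end{pmatrix}\cdot P(X,Y)=P(aX+cY,\,bX+dY)$. Let $M_G$ be the module of coinvariants, i.e. the quotient of $R[X,Y]$ by the $R$-submodule spanned by all $gP-P$ ($g\in G$, $P\in R[X,Y]$). The polynomials $$f_{1,\delta}=(X^pY-XY^p)^{p^{\delta-1}},\qquad f_{2,\delta}=\Big(\frac{X^{p^2-1}-Y^{p^2-1}}{X^{p-1}-Y^{p-1}}\Big)^{p^{\delta-1}}$$ are $G$-invariant, so $M_G$ is a module over the ring $A=R[f_{1,\delta},f_{2,\delta}]\subseteq R[X,Y]$ by multiplication. Let $N\subseteq M_G$ be the $A$-submodule generated by the class $U$ of $$X^{p^{\delta+1}-p^{\delta}+p^{\delta-1}-1}\,Y^{p^{\delta}-1}.$$ 1. $N$ is a free $A$-module of rank one with basis $U$. The class of $1$ generates an $R$-submodule $R\cdot 1$ of $M_G$ that is free of rank one, and $N\cap R\cdot 1=0$. 2. Suppose in addition that $\delta\ge 2$.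 Then $N\oplus R\cdot 1$ is a primitive submodule of $M_G$, that is, it is maximal among the $R$-submodules of $M_G$ that are free over $R$. Every element of $M_G$ of (additive) order $p^\delta$ has the form $c f+h$ with $c\in R^\times$, $f\in N\oplus R\cdot 1$ and $p^{\delta-1}h=0$. If moreover the element is the class of a polynomial with zero constant term, then it has this form with $f\in N$. -/

import Mathlib

open MvPolynomial

namespace SL2Coinv

/-- The `R`-algebra endomorphism `P(X, Y) ↦ P(aX + cY, bX + dY)` of `R[X, Y]` attached to a matrix
`g = (a b; c d)` of `SL₂(R)`. Here `X = X 0` and `Y = X 1`. -/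
noncomputable def subst {R : Type*} [CommRing R] (g : Matrix.SpecialLinearGroup (Fin 2) R) :
    MvPolynomial (Fin 2) R →ₐ[R] MvPolynomial (Fin 2) R :=
  aeval (fun j : Fin 2 => C (g 0 j) * X 0 + C (g 1 j) * X 1)

theorem subst_X {R : Type*} [CommRing R] (g : Matrix.SpecialLinearGroup (Fin 2) R) (j : Fin 2) :
    subst g (X j) = C (g 0 j) * X 0 + C (g 1 j) * X 1 := by
  simp [subst]

theorem subst_one {R : Type*} [CommRing R] :
    subst (1 : Matrix.SpecialLinearGroup (Fin 2) R) = AlgHom.id R _ := by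
  apply MvPolynomial.algHom_ext
  intro j
  rw [subst_X]
  fin_cases j <;> simp

theorem subst_mul {R : Type*} [CommRing R] (g h : Matrix.SpecialLinearGroup (Fin 2) R) :
    subst (g * h) = (subst g).comp (subst h) := by
  apply MvPolynomial.algHom_ext
  intro j
  have hC : ∀ r : R, subst g (C r) = C r := fun r =>
    (subst g).commutes r
  rw [AlgHom.comp_apply, subst_X, subst_X, map_add, map_mul, map_mul, hC, hC, subst_X, subst_X]
  simp only [Matrix.SpecialLinearGroup.coe_mul, Matrix.mul_apply, Fin.sum_univ_two, map_add,
    map_mul]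
  ring

/-- The `R`-linear representation of `SL₂(R)` on `R[X, Y]`. -/
noncomputable def polyRep (R : Type*) [CommRing R] :
    Representation R (Matrix.SpecialLinearGroup (Fin 2) R) (MvPolynomial (Fin 2) R) where
  toFun g := (subst g).toLinearMap
  map_one' := by rw [subst_one]; rfl
  map_mul' g h := by rw [subst_mul]; rfl

theorem polyRep_apply {R : Type*} [CommRing R] (g : Matrix.SpecialLinearGroup (Fin 2) R)
    (f : MvPolynomial (Fin 2) R) : polyRep R g f = subst g f := rfl

/-- The invariant subalgebra `R[X, Y]^{SL₂(R)}`. -/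
noncomputable def invariantRing (R : Type*) [CommRing R] :
    Subalgebra R (MvPolynomial (Fin 2) R) where
  carrier := {f | ∀ g : Matrix.SpecialLinearGroup (Fin 2) R, subst g f = f}
  mul_mem' ha hb g := by rw [map_mul, ha g, hb g]
  add_mem' ha hb g := by rw [map_add, ha g, hb g]
  algebraMap_mem' r g := (subst g).commutes r

/-- Multiplication by an invariant polynomial on the coinvariants. -/
noncomputable def invMul (R : Type*) [CommRing R] :
    invariantRing R →ₐ[R] Module.End R (Representation.Coinvariants (polyRep R)) :=
  AlgHom.ofLinearMap
    { toFun := fun f => Representation.Coinvariants.map (polyRep R) (polyRep R)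
        ((LinearMap.mulLeft R (f : MvPolynomial (Fin 2) R)).intertwiningMap_of_isIntertwiningMap
          (polyRep R) (polyRep R) (fun g v => by
            rw [LinearMap.mulLeft_apply, LinearMap.mulLeft_apply, polyRep_apply, polyRep_apply,
              map_mul, f.2 g]))
      map_add' := fun f f' => by
        ext v
        change Representation.Coinvariants.mk (polyRep R) _ =
          Representation.Coinvariants.mk (polyRep R) _ +
            Representation.Coinvariants.mk (polyRep R) _
        rw [← map_add]
        exact congrArg _ (add_mul (f : MvPolynomial (Fin 2) R) f' _)
      map_smul' := fun r f => by
        ext v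
        change Representation.Coinvariants.mk (polyRep R) _ =
          r • Representation.Coinvariants.mk (polyRep R) _
        rw [← map_smul (Representation.Coinvariants.mk (polyRep R))]
        exact congrArg _ (smul_mul_assoc r (f : MvPolynomial (Fin 2) R) _) }
    (by
      ext v
      change Representation.Coinvariants.mk (polyRep R) (_ * _) =
        Representation.Coinvariants.mk (polyRep R) _
      exact congrArg _ (one_mul _))
    (by
      intro f f'
      ext v
      change Representation.Coinvariants.mk _ _ = Representation.Coinvariants.mk _ _
      exact congrArg _ (mul_assoc (f : MvPolynomial (Fin 2) R) f' _))

theorem invMul_mk (R : Type*) [CommRing R] (f : invariantRing R) (v : MvPolynomial (Fin 2) R) :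
    invMul R f (Representation.Coinvariants.mk (polyRep R) v) =
      Representation.Coinvariants.mk (polyRep R) ((f : MvPolynomial (Fin 2) R) * v) := rfl

/-- `X^p Y - X Y^p`. -/
noncomputable def dickson₁ (R : Type*) [CommRing R] (p : ℕ) : MvPolynomial (Fin 2) R :=
  X 0 ^ p * X 1 - X 0 * X 1 ^ p

/-- `(X^{p²-1} - Y^{p²-1}) / (X^{p-1} - Y^{p-1})`, written out as a geometric sum
(see `dickson₂_mul`). -/
noncomputable def dickson₂ (R : Type*) [CommRing R] (p : ℕ) : MvPolynomial (Fin 2) R :=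
  ∑ i ∈ Finset.range (p + 1), (X 0 ^ (p - 1)) ^ i * (X 1 ^ (p - 1)) ^ (p - i)

theorem dickson₂_mul (R : Type*) [CommRing R] (p : ℕ) :
    dickson₂ R p * (X 0 ^ (p - 1) - X 1 ^ (p - 1)) = X 0 ^ (p ^ 2 - 1) - X 1 ^ (p ^ 2 - 1) := by
  have h := (Commute.all (X 0 ^ (p - 1) : MvPolynomial (Fin 2) R) (X 1 ^ (p - 1))).geom_sum₂_mul
    (p + 1)
  have e : (p - 1) * (p + 1) = p ^ 2 - 1 := by
    rw [mul_comm, ← Nat.sq_sub_sq, one_pow]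
  rw [← pow_mul, ← pow_mul, e] at h
  simpa [dickson₂] using h

theorem dickson₁_mul_dickson₂ (R : Type*) [CommRing R] (p : ℕ) (hp : 1 ≤ p) :
    dickson₁ R p * dickson₂ R p = X 0 ^ p ^ 2 * X 1 - X 0 * X 1 ^ p ^ 2 := by
  have h1 : dickson₁ R p = X 0 * X 1 * (X 0 ^ (p - 1) - X 1 ^ (p - 1)) := by
    obtain ⟨q, rfl⟩ : ∃ q, p = q + 1 := ⟨p - 1, by omega⟩
    simp only [dickson₁, Nat.add_sub_cancel]
    ring
  rw [h1, mul_assoc, mul_comm (_ - _), dickson₂_mul]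
  obtain ⟨q, hq⟩ : ∃ q, p ^ 2 = q + 1 := ⟨p ^ 2 - 1, by have := Nat.one_le_pow 2 p hp; omega⟩
  rw [hq, Nat.add_sub_cancel]
  ring

/-- Modulo `p` every linear substitution of determinant one fixes `X^q Y - X Y^q`, `q = p^k`. -/
theorem aeval_frob {p : ℕ} [Fact p.Prime] (k : ℕ) (a b c d : ZMod p) (h : a * d - b * c = 1)
    (x y : MvPolynomial (Fin 2) (ZMod p)) :
    (C a * x + C c * y) ^ p ^ k * (C b * x + C d * y)
      - (C a * x + C c * y) * (C b * x + C d * y) ^ p ^ k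
    = x ^ p ^ k * y - x * y ^ p ^ k := by
  have hC : (C a * C d - C b * C c : MvPolynomial (Fin 2) (ZMod p)) = 1 := by
    rw [← map_mul, ← map_mul, ← map_sub, h, map_one]
  rw [add_pow_char_pow, add_pow_char_pow]
  simp only [mul_pow, ← map_pow, ZMod.pow_card_pow]
  linear_combination (x ^ p ^ k * y - x * y ^ p ^ k) * hC

theorem map_subst_X {R S : Type*} [CommRing R] [CommRing S] (φ : R →+* S)
    (g : Matrix.SpecialLinearGroup (Fin 2) R) (j : Fin 2) :
    MvPolynomial.map φ (subst g (X j)) =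
      C (φ (g 0 j)) * X 0 + C (φ (g 1 j)) * X 1 := by
  simp [subst_X]

theorem map_dickson₁ {R S : Type*} [CommRing R] [CommRing S] (φ : R →+* S) (p : ℕ) :
    MvPolynomial.map φ (dickson₁ R p) = dickson₁ S p := by
  simp [dickson₁]

theorem map_dickson₂ {R S : Type*} [CommRing R] [CommRing S] (φ : R →+* S) (p : ℕ) :
    MvPolynomial.map φ (dickson₂ R p) = dickson₂ S p := by
  simp [dickson₂]

theorem dickson₁_ne_zero (p : ℕ) [Fact p.Prime] : dickson₁ (ZMod p) p ≠ 0 := by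
  intro h
  have hp := (Fact.out : p.Prime).two_le
  have := congrArg (MvPolynomial.aeval (![Polynomial.X, 1] : Fin 2 → Polynomial (ZMod p))) h
  simp only [dickson₁, map_sub, map_mul, map_pow, aeval_X, Matrix.cons_val_zero,
    Matrix.cons_val_one, one_pow, mul_one, map_zero] at this
  have h2 := congrArg (fun P => Polynomial.coeff P p) this
  simp [Polynomial.coeff_X, show (1 : ℕ) ≠ p by omega] at h2

theorem map_subst_dickson₁ {R : Type*} [CommRing R] {p : ℕ} [Fact p.Prime] (φ : R →+* ZMod p)
    (g : Matrix.SpecialLinearGroup (Fin 2) R) :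
    MvPolynomial.map φ (subst g (dickson₁ R p)) = dickson₁ (ZMod p) p := by
  have hdet : φ (g 0 0) * φ (g 1 1) - φ (g 0 1) * φ (g 1 0) = 1 := by
    have := g.det_coe
    rw [Matrix.det_fin_two] at this
    rw [← map_mul, ← map_mul, ← map_sub, this, map_one]
  have := aeval_frob 1 _ _ _ _ hdet (X 0) (X 1)
  simp only [pow_one] at this
  simp only [dickson₁, map_sub, map_mul, map_pow, map_subst_X]
  exact this

theorem map_subst_dickson₂ {R : Type*} [CommRing R] {p : ℕ} [Fact p.Prime] (φ : R →+* ZMod p)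
    (g : Matrix.SpecialLinearGroup (Fin 2) R) :
    MvPolynomial.map φ (subst g (dickson₂ R p)) = dickson₂ (ZMod p) p := by
  have hp : 1 ≤ p := (Fact.out : p.Prime).one_le
  have hdet : φ (g 0 0) * φ (g 1 1) - φ (g 0 1) * φ (g 1 0) = 1 := by
    have := g.det_coe
    rw [Matrix.det_fin_two] at this
    rw [← map_mul, ← map_mul, ← map_sub, this, map_one]
  apply mul_left_cancel₀ (dickson₁_ne_zero p)
  rw [dickson₁_mul_dickson₂ _ _ hp, ← map_subst_dickson₁ φ g, ← map_mul, ← map_mul,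
    dickson₁_mul_dickson₂ _ _ hp, ← aeval_frob 2 _ _ _ _ hdet (X 0) (X 1)]
  simp only [map_sub, map_mul, map_pow, map_subst_X]

/-- `p^(δ-1)`-th powers of polynomials that are invariant modulo `p` are invariant
over `ℤ/p^δ`. -/
theorem pow_mem_invariantRing {p : ℕ} [Fact p.Prime] (δ : ℕ)
    (F : MvPolynomial (Fin 2) (ZMod (p ^ δ)))
    (hF : ∀ (φ : ZMod (p ^ δ) →+* ZMod p) (g : Matrix.SpecialLinearGroup (Fin 2) (ZMod (p ^ δ))),
      MvPolynomial.map φ (subst g F) = MvPolynomial.map φ F) :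
    F ^ p ^ (δ - 1) ∈ invariantRing (ZMod (p ^ δ)) := by
  intro g
  rcases Nat.eq_zero_or_pos δ with h0 | h0
  · subst h0
    have : Subsingleton (ZMod (p ^ 0)) := by rw [pow_zero]; infer_instance
    exact Subsingleton.elim _ _
  · have hdvd : p ∣ p ^ δ := dvd_pow_self p (by omega)
    have h1 : ((p : ℕ) : MvPolynomial (Fin 2) (ZMod (p ^ δ))) ∣ subst g F - F := by
      have hc : ((p : ℕ) : MvPolynomial (Fin 2) (ZMod (p ^ δ))) = C ((p : ℕ) : ZMod (p ^ δ)) := by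
        simp
      rw [hc, C_dvd_iff_map_hom_eq_zero (ZMod.castHom hdvd (ZMod p))]
      · rw [map_sub, hF, sub_self]
      · intro r
        have : NeZero (p ^ δ) := ⟨pow_ne_zero _ (Fact.out : p.Prime).ne_zero⟩
        obtain ⟨n, rfl⟩ := ZMod.natCast_zmod_surjective r
        rw [map_natCast, ZMod.natCast_eq_zero_iff]
        constructor
        · intro h
          exact_mod_cast Nat.cast_dvd_cast (α := ZMod (p ^ δ)) h
        · rintro ⟨s, hs⟩
          have := congrArg (ZMod.castHom hdvd (ZMod p)) hs
          rw [map_mul, map_natCast, map_natCast, ZMod.natCast_self, zero_mul,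
            ZMod.natCast_eq_zero_iff] at this
          exact this
    have h2 := dvd_sub_pow_of_dvd_sub h1 (δ - 1)
    rw [show δ - 1 + 1 = δ by omega] at h2
    have h3 : ((p : MvPolynomial (Fin 2) (ZMod (p ^ δ))) ^ δ) = 0 := by
      have : ((p ^ δ : ℕ) : ZMod (p ^ δ)) = 0 := ZMod.natCast_self _
      have h4 := congrArg (C : ZMod (p ^ δ) → MvPolynomial (Fin 2) (ZMod (p ^ δ))) this
      rw [map_natCast, map_zero, Nat.cast_pow] at h4
      exact h4
    rw [h3, zero_dvd_iff, sub_eq_zero] at h2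
    rw [map_pow]
    exact h2

/-- `f_{1,δ} = (X^p Y - X Y^p)^{p^{δ-1}}` in `ℤ/p^δ[X, Y]`. -/
noncomputable def f₁ (p δ : ℕ) : MvPolynomial (Fin 2) (ZMod (p ^ δ)) :=
  dickson₁ (ZMod (p ^ δ)) p ^ p ^ (δ - 1)

/-- `f_{2,δ} = ((X^{p²-1} - Y^{p²-1}) / (X^{p-1} - Y^{p-1}))^{p^{δ-1}}` in `ℤ/p^δ[X, Y]`. -/
noncomputable def f₂ (p δ : ℕ) : MvPolynomial (Fin 2) (ZMod (p ^ δ)) :=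
  dickson₂ (ZMod (p ^ δ)) p ^ p ^ (δ - 1)

/-- The ring `ℤ/p^δ[f_{1,δ}, f_{2,δ}]`, as a subalgebra of `ℤ/p^δ[X, Y]`. -/
noncomputable def dicksonRing (p δ : ℕ) :
    Subalgebra (ZMod (p ^ δ)) (MvPolynomial (Fin 2) (ZMod (p ^ δ))) :=
  Algebra.adjoin (ZMod (p ^ δ)) {f₁ p δ, f₂ p δ}

theorem dicksonRing_le (p δ : ℕ) [Fact p.Prime] :
    dicksonRing p δ ≤ invariantRing (ZMod (p ^ δ)) := by
  refine Algebra.adjoin_le ?_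
  rintro f (rfl | rfl)
  · exact pow_mem_invariantRing δ _ fun φ g => by rw [map_subst_dickson₁, map_dickson₁]
  · exact pow_mem_invariantRing δ _ fun φ g => by rw [map_subst_dickson₂, map_dickson₂]

/-- The module of coinvariants of `SL₂(ℤ/p^δ)` on `ℤ/p^δ[X, Y]`. -/
abbrev Coinv (p δ : ℕ) : Type := Representation.Coinvariants (polyRep (ZMod (p ^ δ)))

/-- The class of a polynomial in the coinvariants. -/
noncomputable def cls (p δ : ℕ) : MvPolynomial (Fin 2) (ZMod (p ^ δ)) →ₗ[ZMod (p ^ δ)] Coinv p δ :=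
  Representation.Coinvariants.mk (polyRep (ZMod (p ^ δ)))

/-- The coinvariants as a module over `ℤ/p^δ[f_{1,δ}, f_{2,δ}]`; the action is by multiplication of
polynomials (see `smul_cls`). -/
noncomputable instance (p δ : ℕ) [Fact p.Prime] : Module (dicksonRing p δ) (Coinv p δ) :=
  Module.compHom (Coinv p δ)
    ((invMul (ZMod (p ^ δ))).comp (Subalgebra.inclusion (dicksonRing_le p δ))).toRingHom

theorem smul_cls (p δ : ℕ) [Fact p.Prime] (f : dicksonRing p δ)
    (v : MvPolynomial (Fin 2) (ZMod (p ^ δ))) :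
    f • cls p δ v = cls p δ ((f : MvPolynomial (Fin 2) (ZMod (p ^ δ))) * v) := rfl

instance (p δ : ℕ) [Fact p.Prime] :
    IsScalarTower (ZMod (p ^ δ)) (dicksonRing p δ) (Coinv p δ) where
  smul_assoc r f m := by
    change ((invMul (ZMod (p ^ δ))).comp (Subalgebra.inclusion (dicksonRing_le p δ))) (r • f) m = _
    rw [map_smul]
    rfl

/-- The class of `X^{p^{δ+1} - p^δ + p^{δ-1} - 1} Y^{p^δ - 1}`. -/
noncomputable def topClass (p δ : ℕ) : Coinv p δ :=
  cls p δ (X 0 ^ (p ^ (δ + 1) - p ^ δ + p ^ (δ - 1) - 1) * X 1 ^ (p ^ δ - 1))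

/-- The `ℤ/p^δ[f_{1,δ}, f_{2,δ}]`-submodule of the coinvariants generated by `topClass`. -/
noncomputable def topModule (p δ : ℕ) [Fact p.Prime] : Submodule (dicksonRing p δ) (Coinv p δ) :=
  Submodule.span (dicksonRing p δ) {topClass p δ}

/-- The `ℤ/p^δ`-submodule of the coinvariants generated by the class of the polynomial `1`. -/
noncomputable def oneModule (p δ : ℕ) : Submodule (ZMod (p ^ δ)) (Coinv p δ) :=
  Submodule.span (ZMod (p ^ δ)) {cls p δ 1}

/-- A submodule is primitive if it is maximal among the free submodules. -/
def IsPrimitiveSubmodule {R M : Type*} [CommRing R] [AddCommGroup M] [Module R M]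
    (W : Submodule R M) : Prop :=
  Maximal (fun W' : Submodule R M => Module.Free R W') W

end SL2Coinv

namespace SL2Coinv

/-! ### Divisibility of binomial coefficients and powers -/

/-! Write q = p^(δ-1), let d₁, d₂ be the Dickson invariants modulo p, and L = Y^p - X^(p-1) Y
(`orbitProd`). Everything is read off from p^(δ-1) M_G. Since p^δ = 0, whether p^(δ-1) kills the
class of a polynomial depends only on its reduction modulo p, so the object to understand is the
subgroup `redKer` of F_p[X, Y].

Upper bound, for δ ≥ 2. The substitutions Y ↦ Y + p^k X, expanded to first order, put a nonconstant
monomial X^i Y^j into `redKer` unless q divides both i+1 and j+1. What survives is the constants and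
the twists (XY)^(q-1) Q^q. The same expansion applied to powers of L, averaged over F_p^×, kills the
twists of X^i Y^j L^b with j < p-1 (`frobTwist_orbitProd_mem`). As L is monic in Y, only j = p-1
remains. Torus weights together with X L = -d₁ and d₂ = X^(p²-p) + L^(p-1) reduce this case to
F_p[d₁, d₂]-multiples of X^(p²-p) Y^(p-1) (`mem_twistGen`). The twist of that monomial is the
reduction of the monomial defining U, and q-th powers of Dickson invariants lift to A. Hence p^(δ-1)
M_G is generated by the images of A·U and 1 (`exists_sub_mem_torsionKer`).

Lower bound. If q divides I+1 and J+1, the coefficient of X^I Y^J is invariant under the kernel of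
SL₂(ℤ/p^δ) → SL₂(F_p), so its sum over lifts of SL₂(F_p) is a functional on M_G (`sumCoeff_subst`).
Modulo p, on the twist of Q, it reads off a coefficient of the trace ∑ gQ (`coeff_subst_frobTwist`).
The trace of X^(p²-p) Y^(p-1) is nonzero, and d₁, d₂ are algebraically independent. So if p^(δ-1)
kills F(f₁, f₂)·U, then p divides F (`red_eq_zero_of_mem_torsionKer`), and iterating gives freeness.
The constant term is an invariant functional that splits off R·1.

Primitivity is then a Nakayama argument for the nilpotent element p
(`isPrimitiveSubmodule_of_torsion`). -/

/-- Exponential growth beats v + 2 once p ≥ 3; p = 2 fails at l = 2. It bounds the p-part of the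
denominator l in a binomial coefficient by p^(l-2). -/
theorem pow_padic_add_le {p v l : ℕ} (hp : 3 ≤ p) (hl : 2 ≤ l) (h : p ^ v ∣ l) : v + 2 ≤ l := by
  have h1 : p ^ v ≤ l := Nat.le_of_dvd (by omega) h
  have h2 : 3 ^ v ≤ p ^ v := Nat.pow_le_pow_left hp v
  rcases Nat.eq_zero_or_pos v with rfl | hv
  · omega
  · have : v + 2 ≤ 3 ^ v := by
      clear h h1 h2
      induction v, hv using Nat.le_induction with
      | base => norm_num
      | succ n hn ih => rw [pow_succ]; omega
    omega

theorem pow_dvd_pow_mul_of_dvd_mul {p r l c : ℕ} (hp : p.Prime) (hp3 : 3 ≤ p) (hl : 2 ≤ l)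
    (h : p ^ r ∣ l * c) : p ^ r ∣ p ^ (l - 2) * c := by
  obtain ⟨v, u, hu, rfl⟩ := Nat.exists_eq_pow_mul_and_not_dvd (n := l) (by omega) p hp.ne_one
  have hv := pow_padic_add_le hp3 hl (Dvd.intro _ rfl)
  have hc : (p ^ r).Coprime u := (hp.coprime_iff_not_dvd.2 hu).pow_left r
  have h1 : p ^ r ∣ p ^ v * c := hc.dvd_of_dvd_mul_left (by convert h using 1; ring)
  exact h1.trans (Nat.mul_dvd_mul_right (pow_dvd_pow p (by omega)) c)

/-- From l·C(n, l) = n·C(n-1, l-1): the p-part lost in dividing by l is at most p^(l-2). -/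
theorem pow_dvd_pow_mul_choose {p r n l : ℕ} (hp : p.Prime) (hp3 : 3 ≤ p) (hl : 2 ≤ l)
    (h : p ^ r ∣ n) : p ^ r ∣ p ^ (l - 2) * n.choose l := by
  apply pow_dvd_pow_mul_of_dvd_mul hp hp3 hl
  obtain ⟨l, rfl⟩ : ∃ m, l = m + 1 := ⟨l - 1, by omega⟩
  rcases n with _ | n
  · simp
  · rw [mul_comm, ← Nat.add_one_mul_choose_eq]
    exact h.mul_right _

/-- First order expansion of `(y + p^k c)^n` modulo `p^(k + v_p(n) + 1)`. -/
theorem add_pow_eq_first_order {A : Type*} [CommRing A] {p k r n : ℕ} (hp : p.Prime) (hp3 : 3 ≤ p)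
    (hk : 1 ≤ k) (h : p ^ r ∣ n) (y c : A) :
    ∃ d, (y + (p : A) ^ k * c) ^ n =
      y ^ n + n * (p : A) ^ k * y ^ (n - 1) * c + (p : A) ^ (k + r + 1) * d := by
  have key : ∀ l ∈ Finset.range (n + 1), ∃ d : A,
      ((p : A) ^ k * c) ^ l * y ^ (n - l) * (n.choose l : A) =
      ((if l = 0 then y ^ n else 0) + if l = 1 then n * (p : A) ^ k * y ^ (n - 1) * c else 0)
        + (p : A) ^ (k + r + 1) * d := by
    intro l hl
    rcases Nat.lt_or_ge l 2 with h2 | h2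
    · interval_cases l
      · exact ⟨0, by simp⟩
      · exact ⟨0, by simp; ring⟩
    · obtain ⟨e, he⟩ := pow_dvd_pow_mul_choose hp hp3 h2 h
      have he' : (p : A) ^ (l - 2) * (n.choose l : A) = (p : A) ^ r * e := by
        have := congrArg (Nat.cast : ℕ → A) he
        push_cast at this
        exact this
      -- The surplus m is (k-1)(l-1) ≥ 0. Of the kl factors p, l-2 pay for the denominator of the
      -- binomial coefficient and k+1 remain.
      obtain ⟨m, hm⟩ : ∃ m, k * l = (k + 1) + (l - 2) + m := by
        obtain ⟨l, rfl⟩ : ∃ m, l = m + 2 := ⟨l - 2, by omega⟩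
        refine Nat.exists_eq_add_of_le ?_
        simp only [Nat.add_sub_cancel]
        nlinarith
      refine ⟨(p : A) ^ m * e * c ^ l * y ^ (n - l), ?_⟩
      rw [if_neg (by omega), if_neg (by omega), mul_pow, ← pow_mul, hm]
      simp only [pow_add]
      linear_combination ((p : A) ^ k * (p : A) ^ 1 * (p : A) ^ m * c ^ l * y ^ (n - l)) * he'
  choose! d hd using key
  refine ⟨∑ l ∈ Finset.range (n + 1), d l, ?_⟩
  rw [add_comm y, add_pow, Finset.sum_congr rfl hd, Finset.sum_add_distrib, Finset.sum_add_distrib,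
    Finset.sum_ite_eq', Finset.sum_ite_eq', Finset.mul_sum, if_pos (by simp)]
  split_ifs with h1
  · rfl
  · obtain rfl : n = 0 := by simpa using h1
    simp

/-- From l·C(n, l) = (n-l+1)·C(n, l-1). Here all l factors p are available, which leaves at least
one to spare. -/
theorem pow_dvd_pow_mul_choose_of_dvd_sub {p r n l : ℕ} (hp : p.Prime) (hp3 : 3 ≤ p) (hl : 1 ≤ l)
    (hln : l ≤ n) (h : p ^ r ∣ n - l + 1) : p ^ (r + 1) ∣ p ^ l * n.choose l := by
  obtain ⟨l, rfl⟩ : ∃ m, l = m + 1 := ⟨l - 1, by omega⟩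
  have h1 : p ^ r ∣ (l + 1) * n.choose (l + 1) := by
    rw [mul_comm, Nat.choose_succ_right_eq]
    exact (h.trans (by rw [show n - (l + 1) + 1 = n - l by omega])).mul_left _
  rcases l with _ | l
  · rw [zero_add, one_mul] at h1
    rw [pow_succ', zero_add, pow_one]
    exact Nat.mul_dvd_mul_left p h1
  · have h2 := pow_dvd_pow_mul_of_dvd_mul hp hp3 (by omega) h1
    rw [pow_succ', show p ^ (l + 1 + 1) * n.choose (l + 1 + 1)
      = p * (p * (p ^ (l + 1 + 1 - 2) * n.choose (l + 1 + 1))) by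
        rw [show l + 1 + 1 - 2 = l by omega]; ring]
    exact Nat.mul_dvd_mul_left p (h2.mul_left p)

/-- In characteristic `p`, `(x - y)^(p^n - 1)` is a geometric sum. -/
theorem sub_pow_char_pow_sub_one {A : Type*} [CommRing A] [IsDomain A] {p : ℕ} [Fact p.Prime]
    [CharP A p] (n : ℕ) (x y : A) :
    (x - y) ^ (p ^ n - 1) = ∑ i ∈ Finset.range (p ^ n), x ^ i * y ^ (p ^ n - 1 - i) := by
  have hp := (Fact.out : p.Prime)
  by_cases h : x = y
  · subst h
    rcases Nat.eq_zero_or_pos n with rfl | hn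
    · simp
    · have h1 : ∀ i ∈ Finset.range (p ^ n), x ^ i * x ^ (p ^ n - 1 - i) = x ^ (p ^ n - 1) := by
        intro i hi
        have hi := Finset.mem_range.1 hi
        rw [← pow_add]
        congr 1
        omega
      have h2 : 1 < p ^ n := Nat.one_lt_pow (by omega) hp.one_lt
      rw [Finset.sum_congr rfl h1, Finset.sum_const, Finset.card_range, nsmul_eq_mul, Nat.cast_pow,
        CharP.cast_eq_zero, zero_pow (by omega), zero_mul, sub_self, zero_pow (by omega)]
  · apply mul_right_cancel₀ (sub_ne_zero.2 h)
    rw [(Commute.all x y).geom_sum₂_mul, ← sub_pow_char_pow, ← pow_succ,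
      Nat.sub_add_cancel (Nat.one_le_pow _ _ hp.pos)]

theorem mem_of_C_mul_X_pow_mul_X_pow_mem {R : Type*} [CommRing R] (S : AddSubgroup (MvPolynomial (Fin 2) R))
    (h : ∀ (c : R) (i j : ℕ), C c * (X 0 ^ i * X 1 ^ j) ∈ S) (P : MvPolynomial (Fin 2) R) :
    P ∈ S := by
  induction P using MvPolynomial.induction_on' with
  | monomial u a =>
    have := h a (u 0) (u 1)
    rwa [show monomial u a = C a * (X 0 ^ u 0 * X 1 ^ u 1) by
      rw [monomial_eq, Finsupp.prod_fintype _ _ (by simp), Fin.prod_univ_two]]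
  | add p q hp hq => exact S.add_mem hp hq

section

/-! ### Reduction modulo `p` -/

variable {p δ : ℕ}

/-- Reduction `ℤ/p^δ → ℤ/p`. -/
def redHom (p δ : ℕ) [NeZero δ] : ZMod (p ^ δ) →+* ZMod p :=
  ZMod.castHom (dvd_pow_self p (NeZero.ne δ)) (ZMod p)

/-- Reduction of polynomials modulo `p`. -/
noncomputable def red (p δ : ℕ) [NeZero δ] :
    MvPolynomial (Fin 2) (ZMod (p ^ δ)) →+* MvPolynomial (Fin 2) (ZMod p) :=
  MvPolynomial.map (redHom p δ)

/-- The order-`p^δ`-detecting kernel: polynomials whose class is killed by `p^(δ-1)`. -/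
noncomputable def torsionKer (p δ : ℕ) :
    Submodule (ZMod (p ^ δ)) (MvPolynomial (Fin 2) (ZMod (p ^ δ))) :=
  LinearMap.ker ((p : ZMod (p ^ δ)) ^ (δ - 1) • cls p δ)

theorem mem_torsionKer {P : MvPolynomial (Fin 2) (ZMod (p ^ δ))} :
    P ∈ torsionKer p δ ↔ (p : ZMod (p ^ δ)) ^ (δ - 1) • cls p δ P = 0 := Iff.rfl

theorem cls_subst (g : Matrix.SpecialLinearGroup (Fin 2) (ZMod (p ^ δ)))
    (P : MvPolynomial (Fin 2) (ZMod (p ^ δ))) : cls p δ (subst g P) = cls p δ P :=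
  Representation.Coinvariants.mk_self_apply (polyRep _) g P

theorem mul_mem_torsionKer [Fact p.Prime] {f P : MvPolynomial (Fin 2) (ZMod (p ^ δ))}
    (hf : f ∈ dicksonRing p δ) (hP : P ∈ torsionKer p δ) : f * P ∈ torsionKer p δ := by
  rw [mem_torsionKer] at *
  rw [← smul_cls p δ ⟨f, hf⟩, smul_comm, hP, smul_zero]

theorem natCast_pow_eq_zero (p δ : ℕ) : (p : ZMod (p ^ δ)) ^ δ = 0 := by
  exact_mod_cast ZMod.natCast_self (p ^ δ)

theorem poly_natCast_pow_eq_zero (p δ : ℕ) :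
    (p : MvPolynomial (Fin 2) (ZMod (p ^ δ))) ^ δ = 0 := by
  have := congrArg (C : ZMod (p ^ δ) → MvPolynomial (Fin 2) (ZMod (p ^ δ)))
    (natCast_pow_eq_zero p δ)
  simpa using this

variable [NeZero δ]

theorem redHom_surjective : Function.Surjective (redHom p δ) :=
  ZMod.castHom_surjective _

theorem red_surjective : Function.Surjective (red p δ) :=
  MvPolynomial.map_surjective _ redHom_surjective

@[simp] theorem red_X (i : Fin 2) : red p δ (X i) = X i := map_X _ _

@[simp] theorem red_C (c : ZMod (p ^ δ)) : red p δ (C c) = C (redHom p δ c) := map_C _ _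

theorem coeff_red (m : Fin 2 →₀ ℕ) (P : MvPolynomial (Fin 2) (ZMod (p ^ δ))) :
    coeff m (red p δ P) = redHom p δ (coeff m P) := coeff_map _ _ _

theorem redHom_eq_zero_iff [Fact p.Prime] (r : ZMod (p ^ δ)) :
    redHom p δ r = 0 ↔ (p : ZMod (p ^ δ)) ∣ r := by
  have : NeZero (p ^ δ) := ⟨pow_ne_zero _ (Fact.out : p.Prime).ne_zero⟩
  constructor
  · obtain ⟨n, rfl⟩ := ZMod.natCast_zmod_surjective r
    rw [map_natCast, ZMod.natCast_eq_zero_iff]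
    intro h
    exact_mod_cast Nat.cast_dvd_cast (α := ZMod (p ^ δ)) h
  · rintro ⟨s, rfl⟩
    rw [map_mul, map_natCast, ZMod.natCast_self, zero_mul]

theorem pow_mul_eq_zero_iff [Fact p.Prime] (r : ZMod (p ^ δ)) :
    (p : ZMod (p ^ δ)) ^ (δ - 1) * r = 0 ↔ redHom p δ r = 0 := by
  have hp := (Fact.out : p.Prime)
  have : NeZero (p ^ δ) := ⟨pow_ne_zero _ hp.ne_zero⟩
  have hδ : δ - 1 + 1 = δ := Nat.sub_add_cancel (NeZero.one_le)
  obtain ⟨n, rfl⟩ := ZMod.natCast_zmod_surjective r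
  rw [map_natCast, ZMod.natCast_eq_zero_iff, ← Nat.cast_pow, ← Nat.cast_mul,
    ZMod.natCast_eq_zero_iff]
  conv_lhs => rw [← hδ, pow_succ]
  exact Nat.mul_dvd_mul_iff_left (pow_pos hp.pos _)

theorem isUnit_iff_redHom_ne_zero [Fact p.Prime] (r : ZMod (p ^ δ)) :
    IsUnit r ↔ redHom p δ r ≠ 0 := by
  have hp := (Fact.out : p.Prime)
  have : NeZero (p ^ δ) := ⟨pow_ne_zero _ hp.ne_zero⟩
  obtain ⟨n, rfl⟩ := ZMod.natCast_zmod_surjective r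
  rw [map_natCast, Ne, ZMod.natCast_eq_zero_iff, ZMod.isUnit_iff_coprime,
    Nat.coprime_pow_right_iff (NeZero.pos δ), Nat.coprime_comm, hp.coprime_iff_not_dvd]

theorem red_eq_zero_iff [Fact p.Prime] (P : MvPolynomial (Fin 2) (ZMod (p ^ δ))) :
    red p δ P = 0 ↔ (p : MvPolynomial (Fin 2) (ZMod (p ^ δ))) ∣ P := by
  rw [show (p : MvPolynomial (Fin 2) (ZMod (p ^ δ))) = C (p : ZMod (p ^ δ)) by simp]
  exact (C_dvd_iff_map_hom_eq_zero _ _ redHom_eq_zero_iff P).symm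

/-- The reductions modulo `p` of the polynomials whose class is killed by `p^(δ-1)`. -/
noncomputable def redKer (p δ : ℕ) [NeZero δ] : AddSubgroup (MvPolynomial (Fin 2) (ZMod p)) :=
  (torsionKer p δ).toAddSubgroup.map (red p δ).toAddMonoidHom

/-- Two polynomials with the same reduction differ by a multiple of p, and p^(δ-1)·p = 0. So being
killed by p^(δ-1) can be tested modulo p. -/
theorem mem_redKer_iff [Fact p.Prime] {P : MvPolynomial (Fin 2) (ZMod (p ^ δ))} :
    red p δ P ∈ redKer p δ ↔ P ∈ torsionKer p δ := by
  refine ⟨?_, fun h => ⟨P, h, rfl⟩⟩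
  rintro ⟨Q, hQ, hQP⟩
  have h0 : red p δ (P - Q) = 0 := by rw [map_sub, sub_eq_zero]; exact hQP.symm
  obtain ⟨W, hW⟩ := (red_eq_zero_iff _).1 h0
  have : P - Q ∈ torsionKer p δ := by
    rw [mem_torsionKer, ← map_smul, hW, smul_eq_C_mul]
    have h2 : (C ((p : ZMod (p ^ δ)) ^ (δ - 1)) : MvPolynomial (Fin 2) (ZMod (p ^ δ)))
        * ((p : MvPolynomial (Fin 2) (ZMod (p ^ δ))) * W) = 0 := by
      rw [map_pow, map_natCast, ← mul_assoc, ← pow_succ, Nat.sub_add_cancel NeZero.one_le,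
        poly_natCast_pow_eq_zero, zero_mul]
    rw [h2, map_zero]
  have h3 := (torsionKer p δ).add_mem this hQ
  rwa [sub_add_cancel] at h3

theorem C_mul_mem_redKer [Fact p.Prime] {P : MvPolynomial (Fin 2) (ZMod p)} (h : P ∈ redKer p δ)
    (c : ZMod p) : C c * P ∈ redKer p δ := by
  rw [show (C c : MvPolynomial (Fin 2) (ZMod p)) = (c.val : MvPolynomial (Fin 2) (ZMod p)) by
    rw [← map_natCast (C : ZMod p →+* MvPolynomial (Fin 2) (ZMod p)), ZMod.natCast_zmod_val],
    ← nsmul_eq_mul]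
  exact (redKer p δ).nsmul_mem h _

theorem mem_redKer_of_C_mul_mem [Fact p.Prime] {P : MvPolynomial (Fin 2) (ZMod p)} {c : ZMod p}
    (hc : c ≠ 0) (h : C c * P ∈ redKer p δ) : P ∈ redKer p δ := by
  have := C_mul_mem_redKer h c⁻¹
  rwa [← mul_assoc, ← map_mul, inv_mul_cancel₀ hc, map_one, one_mul] at this

/-! ### Reduction and lifting of matrices; unipotent, Weyl and torus elements -/

theorem map_subst {R S : Type*} [CommRing R] [CommRing S] (φ : R →+* S)
    (g : Matrix.SpecialLinearGroup (Fin 2) R) (P : MvPolynomial (Fin 2) R) :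
    MvPolynomial.map φ (subst g P) =
      subst (Matrix.SpecialLinearGroup.map φ g) (MvPolynomial.map φ P) := by
  induction P using MvPolynomial.induction_on with
  | C a =>
    have h1 : subst g (C a) = C a := (subst g).commutes a
    have h2 : subst (Matrix.SpecialLinearGroup.map φ g) (C (φ a)) = C (φ a) :=
      (subst _).commutes (φ a)
    rw [h1, map_C, h2]
  | add P Q hP hQ => simp only [map_add, hP, hQ]
  | mul_X P i hP =>
    rw [map_mul, map_mul, hP, map_subst_X, map_mul, map_mul, map_X, subst_X]
    rfl

theorem subst_C {R : Type*} [CommRing R] (g : Matrix.SpecialLinearGroup (Fin 2) R) (a : R) :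
    subst g (C a) = C a := (subst g).commutes a

/-- Reduction `SL₂(ℤ/p^δ) → SL₂(ℤ/p)` is onto. -/
theorem exists_lift_SL2 [Fact p.Prime] (g : Matrix.SpecialLinearGroup (Fin 2) (ZMod p)) :
    ∃ h : Matrix.SpecialLinearGroup (Fin 2) (ZMod (p ^ δ)),
      Matrix.SpecialLinearGroup.map (redHom p δ) h = g := by
  choose l hl using redHom_surjective (p := p) (δ := δ)
  have hg : g 0 0 * g 1 1 - g 0 1 * g 1 0 = 1 := by
    rw [← Matrix.det_fin_two]; exact g.det_coe
  -- An entrywise lift has determinant e ≡ 1 modulo p, hence a unit; scaling the first row by its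
  -- inverse makes the determinant 1 without changing the reduction.
  set e := l (g 0 0) * l (g 1 1) - l (g 0 1) * l (g 1 0) with he
  have hre : redHom p δ e = 1 := by simp [he, hl, hg]
  obtain ⟨u, hu⟩ := (isUnit_iff_redHom_ne_zero e).2 (by rw [hre]; exact one_ne_zero)
  have hru : redHom p δ (↑u⁻¹ : ZMod (p ^ δ)) = 1 := by
    have : redHom p δ ((u : ZMod (p ^ δ)) * ↑u⁻¹) = 1 := by rw [Units.mul_inv, map_one]
    rwa [map_mul, hu, hre, one_mul] at this
  have hue : (↑u⁻¹ : ZMod (p ^ δ)) * e = 1 := by rw [← hu, Units.inv_mul]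
  refine ⟨⟨!![↑u⁻¹ * l (g 0 0), ↑u⁻¹ * l (g 0 1); l (g 1 0), l (g 1 1)], ?_⟩, ?_⟩
  · rw [Matrix.det_fin_two_of]
    rw [he] at hue
    linear_combination hue
  · have key : ∀ i j, redHom p δ
        ((!![↑u⁻¹ * l (g 0 0), ↑u⁻¹ * l (g 0 1); l (g 1 0), l (g 1 1)] :
          Matrix (Fin 2) (Fin 2) (ZMod (p ^ δ))) i j) = g i j := by
      intro i j
      fin_cases i <;> fin_cases j <;> simp [hl, hru]
    exact Matrix.SpecialLinearGroup.ext _ _ key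

theorem subst_sub_mem_redKer [Fact p.Prime] (g : Matrix.SpecialLinearGroup (Fin 2) (ZMod p))
    (P : MvPolynomial (Fin 2) (ZMod p)) : subst g P - P ∈ redKer p δ := by
  obtain ⟨h, rfl⟩ := exists_lift_SL2 (δ := δ) g
  obtain ⟨P, rfl⟩ := red_surjective (δ := δ) P
  have : red p δ (subst h P - P) ∈ redKer p δ := by
    rw [mem_redKer_iff, mem_torsionKer, map_sub, cls_subst, sub_self, smul_zero]
  rw [map_sub] at this
  rwa [red, map_subst] at this

/-- The unipotent matrix acting by `Y ↦ Y + tX`. -/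
def unip {R : Type*} [CommRing R] (t : R) : Matrix.SpecialLinearGroup (Fin 2) R :=
  ⟨!![1, t; 0, 1], by simp⟩

@[simp] theorem subst_unip_X0 {R : Type*} [CommRing R] (t : R) : subst (unip t) (X 0) = X 0 := by
  rw [subst_X]; simp [unip]

@[simp] theorem subst_unip_X1 {R : Type*} [CommRing R] (t : R) :
    subst (unip t) (X 1) = X 1 + C t * X 0 := by
  rw [subst_X]; simp [unip, add_comm]

/-- The Weyl element acting by `X ↦ Y`, `Y ↦ -X`. -/
def weyl (R : Type*) [CommRing R] : Matrix.SpecialLinearGroup (Fin 2) R :=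
  ⟨!![0, -1; 1, 0], by simp⟩

@[simp] theorem subst_weyl_X0 {R : Type*} [CommRing R] : subst (weyl R) (X 0) = X 1 := by
  rw [subst_X]; simp [weyl]

@[simp] theorem subst_weyl_X1 {R : Type*} [CommRing R] : subst (weyl R) (X 1) = - X 0 := by
  rw [subst_X]; simp [weyl]

/-- The diagonal matrix acting by `X ↦ aX`, `Y ↦ a⁻¹Y`. -/
def torus {R : Type*} [CommRing R] (a : Rˣ) : Matrix.SpecialLinearGroup (Fin 2) R :=
  ⟨!![(a : R), 0; 0, (↑a⁻¹ : R)], by simp⟩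

@[simp] theorem subst_torus_X0 {R : Type*} [CommRing R] (a : Rˣ) :
    subst (torus a) (X 0) = C (a : R) * X 0 := by
  rw [subst_X]; simp [torus]

@[simp] theorem subst_torus_X1 {R : Type*} [CommRing R] (a : Rˣ) :
    subst (torus a) (X 1) = C (↑a⁻¹ : R) * X 1 := by
  rw [subst_X]; simp [torus]

end

section

/-! ### Polynomials killed by `p^(δ-1)` in the coinvariants -/

variable {p δ : ℕ} [Fact p.Prime]

/-- `Q ↦ (XY)^(q-1) Q^q` with `q = p^(δ-1)`. -/
noncomputable def frobTwist (p δ : ℕ) [Fact p.Prime] :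
    MvPolynomial (Fin 2) (ZMod p) →+ MvPolynomial (Fin 2) (ZMod p) :=
  (AddMonoidHom.mulLeft ((X 0 * X 1) ^ (p ^ (δ - 1) - 1))).comp
    (iterateFrobenius (MvPolynomial (Fin 2) (ZMod p)) p (δ - 1)).toAddMonoidHom

theorem frobTwist_apply (Q : MvPolynomial (Fin 2) (ZMod p)) :
    frobTwist p δ Q = (X 0 * X 1) ^ (p ^ (δ - 1) - 1) * Q ^ p ^ (δ - 1) := rfl

variable [NeZero δ]

/-- The source of relations beyond those of SL₂(F_p): whenever g moves P only by p^(δ-1) Q, the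
class of Q is killed by p^(δ-1). -/
theorem red_mem_redKer_of_subst {g : Matrix.SpecialLinearGroup (Fin 2) (ZMod (p ^ δ))}
    {P Q : MvPolynomial (Fin 2) (ZMod (p ^ δ))}
    (h : subst g P - P = (p : MvPolynomial (Fin 2) (ZMod (p ^ δ))) ^ (δ - 1) * Q) :
    red p δ Q ∈ redKer p δ := by
  rw [mem_redKer_iff, mem_torsionKer, ← map_smul, smul_eq_C_mul, map_pow, map_natCast, ← h,
    map_sub, cls_subst, sub_self]

/-- With r = v_p(j+1) < δ-1, the substitution Y ↦ Y + p^(δ-1-r) X moves X^(i-1) Y^(j+1) by a unit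
multiple of p^(δ-1) X^i Y^j, all higher terms vanishing modulo p^δ. -/
theorem X_pow_mul_X_pow_mem_redKer (hp3 : 3 ≤ p) {i j : ℕ} (hi : 1 ≤ i) (h : ¬ p ^ (δ - 1) ∣ j + 1) :
    X 0 ^ i * X 1 ^ j ∈ redKer p δ := by
  have hp := (Fact.out : p.Prime)
  obtain ⟨r, m, hm, hJ⟩ := Nat.exists_eq_pow_mul_and_not_dvd (n := j + 1) (by omega) p hp.ne_one
  have hr : r < δ - 1 := by
    by_contra! hr
    exact h (hJ ▸ (pow_dvd_pow p hr).mul_right m)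
  obtain ⟨i, rfl⟩ : ∃ i', i = i' + 1 := ⟨i - 1, by omega⟩
  obtain ⟨d, hd⟩ := add_pow_eq_first_order (A := MvPolynomial (Fin 2) (ZMod (p ^ δ))) hp hp3
    (k := δ - 1 - r) (r := r) (n := j + 1) (by omega) ⟨m, hJ⟩ (X 1) (X 0)
  rw [show δ - 1 - r + r + 1 = δ by omega, poly_natCast_pow_eq_zero, zero_mul, add_zero] at hd
  have hJ' : ((j + 1 : ℕ) : MvPolynomial (Fin 2) (ZMod (p ^ δ))) = p ^ r * m := by
    rw [hJ]; push_cast; ring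
  have hpow : (p : MvPolynomial (Fin 2) (ZMod (p ^ δ))) ^ (δ - 1)
      = p ^ r * p ^ (δ - 1 - r) := by
    rw [← pow_add]; congr 1; omega
  have key := red_mem_redKer_of_subst (g := unip ((p : ZMod (p ^ δ)) ^ (δ - 1 - r)))
    (P := X 0 ^ i * X 1 ^ (j + 1)) (Q := (m : MvPolynomial (Fin 2) (ZMod (p ^ δ))) *
      (X 0 ^ (i + 1) * X 1 ^ j)) (by
    rw [map_mul, map_pow, map_pow, subst_unip_X0, subst_unip_X1, map_pow, map_natCast, hd, hJ',
      hpow, Nat.add_sub_cancel]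
    ring)
  rw [map_mul, map_mul, map_pow, map_pow, red_X, red_X, map_natCast,
    ← map_natCast (C : ZMod p →+* MvPolynomial (Fin 2) (ZMod p))] at key
  refine mem_redKer_of_C_mul_mem ?_ key
  rwa [Ne, ZMod.natCast_eq_zero_iff]

theorem X_pow_mul_X_pow_mem_redKer' (hp3 : 3 ≤ p) {i j : ℕ} (hj : 1 ≤ j)
    (h : ¬ p ^ (δ - 1) ∣ i + 1) : X 0 ^ i * X 1 ^ j ∈ redKer p δ := by
  have h1 := X_pow_mul_X_pow_mem_redKer hp3 hj h
  have h2 := (redKer p δ).add_mem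
    (subst_sub_mem_redKer (δ := δ) (weyl (ZMod p)) (X 0 ^ j * X 1 ^ i)) h1
  rw [sub_add_cancel, map_mul, map_pow, map_pow, subst_weyl_X0, subst_weyl_X1, neg_pow,
    show (X 1 ^ j * ((-1) ^ i * X 0 ^ i) : MvPolynomial (Fin 2) (ZMod p))
      = C ((-1) ^ i) * (X 0 ^ i * X 1 ^ j) by simp; ring] at h2
  exact mem_redKer_of_C_mul_mem (by simp) h2

/-- A q-th power only involves exponents divisible by q, so it leaves the residue of j+1 modulo q
unchanged. -/
theorem X_pow_mul_X_pow_mul_pow_mem_redKer (hp3 : 3 ≤ p) {i j : ℕ} (hi : 1 ≤ i)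
    (h : ¬ p ^ (δ - 1) ∣ j + 1) (Q : MvPolynomial (Fin 2) (ZMod p)) :
    X 0 ^ i * X 1 ^ j * Q ^ p ^ (δ - 1) ∈ redKer p δ := by
  refine mem_of_C_mul_X_pow_mul_X_pow_mem ((redKer p δ).comap ((AddMonoidHom.mulLeft (X 0 ^ i * X 1 ^ j)).comp
    (iterateFrobenius (MvPolynomial (Fin 2) (ZMod p)) p (δ - 1)).toAddMonoidHom))
    (fun c a b => ?_) Q
  change X 0 ^ i * X 1 ^ j * (C c * (X 0 ^ a * X 1 ^ b)) ^ p ^ (δ - 1) ∈ redKer p δ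
  have h1 := C_mul_mem_redKer (X_pow_mul_X_pow_mem_redKer (p := p) (δ := δ) hp3
    (i := i + a * p ^ (δ - 1)) (j := j + b * p ^ (δ - 1)) (by omega) (by
      rw [add_right_comm]
      exact fun h' => h ((Nat.dvd_add_left (Dvd.intro_left b rfl)).1 h'))) (c ^ p ^ (δ - 1))
  convert h1 using 1
  rw [map_pow, pow_add, pow_add, pow_mul, pow_mul]
  ring

/-- The orbit product `Y^p - X^(p-1) Y` of `Y` under `Y ↦ Y + tX`. -/
noncomputable def orbitProd (R : Type*) [CommRing R] (p : ℕ) : MvPolynomial (Fin 2) R :=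
  X 1 ^ p - X 0 ^ (p - 1) * X 1

theorem red_orbitProd : red p δ (orbitProd _ p) = orbitProd _ p := by
  simp [orbitProd]

/-- Under Y ↦ Y + tX the orbit product changes by p·D + (t^p - t) X^p, where D is the displayed sum
with t in place of τ. Choosing t with t^p ≡ t modulo p² makes the second term invisible, and the
power b·p^(δ-2) turns the first-order term into b·p^(δ-1) times the asserted element. -/
theorem orbitProd_unip_sum_mem (hδ : 2 ≤ δ) (hp3 : 3 ≤ p) {b : ℕ} (hb : ¬ p ∣ b) (i : ℕ)
    (τ : ZMod p) :
    X 0 ^ i * orbitProd (ZMod p) p ^ (b * p ^ (δ - 2) - 1) *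
      (∑ l ∈ Finset.Ioo 0 p, X 1 ^ l * (C τ * X 0) ^ (p - l) * ((p.choose l / p : ℕ) :
        MvPolynomial (Fin 2) (ZMod p))) ∈ redKer p δ := by
  have hp := (Fact.out : p.Prime)
  have hp1 : p - 1 + 1 = p := by omega
  -- a multiplicative lift of `τ` modulo `p²`
  obtain ⟨t, ht, htp⟩ : ∃ t : ZMod (p ^ δ), redHom p δ t = τ ∧
      ∃ u, t ^ p - t = (p : ZMod (p ^ δ)) ^ 2 * u := by
    obtain ⟨s, rfl⟩ := redHom_surjective (δ := δ) τ
    -- From s^p ≡ s modulo p one gets (s^p)^p ≡ s^p modulo p².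
    refine ⟨s ^ p, by rw [map_pow, ZMod.pow_card], ?_⟩
    have h1 : (p : ZMod (p ^ δ)) ∣ s ^ p - s := by
      rw [← redHom_eq_zero_iff, map_sub, map_pow, ZMod.pow_card, sub_self]
    have h2 := dvd_sub_pow_of_dvd_sub h1 1
    rw [pow_one] at h2
    exact h2
  obtain ⟨u, hu⟩ := htp
  set A := MvPolynomial (Fin 2) (ZMod (p ^ δ)) with hA
  set D : A := ∑ l ∈ Finset.Ioo 0 p, X 1 ^ l * (C t * X 0) ^ (p - l) * ((p.choose l / p : ℕ) : A)
    with hD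
  have hu' : (C t : A) ^ p = C t + (p : A) ^ 2 * C u := by
    have := congrArg (C : ZMod (p ^ δ) → A) hu
    simp only [map_sub, map_pow, map_mul, map_natCast] at this
    linear_combination this
  have hN : subst (unip t) (orbitProd (ZMod (p ^ δ)) p) = orbitProd (ZMod (p ^ δ)) p
      + (p : A) ^ 1 * (D + (p : A) * C u * X 0 ^ p) := by
    rw [orbitProd, map_sub, map_mul, map_pow, map_pow, subst_unip_X0, subst_unip_X1,
      add_pow_prime_eq' hp, ← hD, mul_pow, hu']
    have : (X 0 : A) ^ p = X 0 ^ (p - 1) * X 0 := by rw [← pow_succ, hp1]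
    rw [this]
    ring
  obtain ⟨d, hd⟩ := add_pow_eq_first_order (A := A) hp hp3 (k := 1) (r := δ - 2)
    (n := b * p ^ (δ - 2)) le_rfl (Dvd.intro_left b rfl) (orbitProd (ZMod (p ^ δ)) p)
    (D + (p : A) * C u * X 0 ^ p)
  rw [show 1 + (δ - 2) + 1 = δ by omega, poly_natCast_pow_eq_zero, zero_mul, add_zero] at hd
  have hpow : (p : A) ^ (δ - 1) = p ^ (δ - 2) * p := by
    rw [← pow_succ]; congr 1; omega
  have key := red_mem_redKer_of_subst (g := unip t)
    (P := X 0 ^ i * orbitProd (ZMod (p ^ δ)) p ^ (b * p ^ (δ - 2)))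
    (Q := (b : A) * (X 0 ^ i * orbitProd (ZMod (p ^ δ)) p ^ (b * p ^ (δ - 2) - 1)
      * (D + (p : A) * C u * X 0 ^ p))) (by
    rw [map_mul, map_pow, map_pow, subst_unip_X0, hN, hd, hpow]
    push_cast
    ring)
  have hredD : red p δ (D + (p : A) * C u * X 0 ^ p) =
      ∑ l ∈ Finset.Ioo 0 p, X 1 ^ l * (C τ * X 0) ^ (p - l) * ((p.choose l / p : ℕ) :
        MvPolynomial (Fin 2) (ZMod p)) := by
    have h0 : (p : MvPolynomial (Fin 2) (ZMod p)) = 0 := CharP.cast_eq_zero _ p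
    rw [map_add, map_mul, map_mul, map_natCast, h0, zero_mul, zero_mul, add_zero, hD, map_sum]
    simp only [map_mul, map_pow, red_X, red_C, map_natCast, ht]
  rw [map_mul, map_mul, map_mul, map_pow, map_pow, red_X, red_orbitProd, hredD, map_natCast,
    ← map_natCast (C : ZMod p →+* MvPolynomial (Fin 2) (ZMod p))] at key
  refine mem_redKer_of_C_mul_mem ?_ key
  rwa [Ne, ZMod.natCast_eq_zero_iff]

/-- Weighting the previous relation by τ⁻¹ and summing over F_p^× isolates the summand l = p-1,
whose coefficient C(p, p-1)/p is 1. -/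
theorem orbitProd_pow_mem_redKer (hδ : 2 ≤ δ) (hp3 : 3 ≤ p) {b : ℕ} (hb : ¬ p ∣ b) (i : ℕ) :
    X 0 ^ (i + 1) * X 1 ^ (p - 1) * orbitProd (ZMod p) p ^ (b * p ^ (δ - 2) - 1) ∈ redKer p δ := by
  classical
  have hp := (Fact.out : p.Prime)
  set F : MvPolynomial (Fin 2) (ZMod p) :=
    X 0 ^ i * orbitProd (ZMod p) p ^ (b * p ^ (δ - 2) - 1) with hF
  have h1 : ∑ τ : (ZMod p)ˣ, C (↑τ⁻¹ : ZMod p) * (F *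
      (∑ l ∈ Finset.Ioo 0 p, X 1 ^ l * (C (τ : ZMod p) * X 0) ^ (p - l) * ((p.choose l / p : ℕ) :
        MvPolynomial (Fin 2) (ZMod p)))) ∈ redKer p δ :=
    (redKer p δ).sum_mem fun τ _ => C_mul_mem_redKer (orbitProd_unip_sum_mem hδ hp3 hb i τ) _
  have h2 : ∀ τ : (ZMod p)ˣ, C (↑τ⁻¹ : ZMod p) * (F *
      (∑ l ∈ Finset.Ioo 0 p, X 1 ^ l * (C (τ : ZMod p) * X 0) ^ (p - l) * ((p.choose l / p : ℕ) :
        MvPolynomial (Fin 2) (ZMod p)))) =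
      ∑ l ∈ Finset.Ioo 0 p, C ((τ : ZMod p) ^ (p - l - 1)) * (F * (X 1 ^ l * X 0 ^ (p - l) *
        ((p.choose l / p : ℕ) : MvPolynomial (Fin 2) (ZMod p)))) := by
    intro τ
    rw [Finset.mul_sum, Finset.mul_sum]
    refine Finset.sum_congr rfl fun l hl => ?_
    have hl := Finset.mem_Ioo.1 hl
    have h3 : (C (↑τ⁻¹ : ZMod p) : MvPolynomial (Fin 2) (ZMod p)) * C (τ : ZMod p) = 1 := by
      rw [← map_mul, Units.inv_mul, map_one]
    obtain ⟨m, hm⟩ : ∃ m, p - l = m + 1 := ⟨p - l - 1, by omega⟩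
    rw [hm, Nat.add_sub_cancel, mul_pow, map_pow]
    linear_combination (F * X 1 ^ l * X 0 ^ (m + 1) * C (τ : ZMod p) ^ m *
      ((p.choose l / p : ℕ) : MvPolynomial (Fin 2) (ZMod p))) * h3
  rw [Finset.sum_congr rfl fun τ _ => h2 τ, Finset.sum_comm] at h1
  simp only [← Finset.sum_mul, ← map_sum] at h1
  -- A sum of τ^n over F_p^× vanishes unless p-1 divides n; for 0 < l < p this leaves only n = p-l-1
  -- = 0.
  have h4 : ∀ l ∈ Finset.Ioo 0 p, (∑ τ : (ZMod p)ˣ, (τ : ZMod p) ^ (p - l - 1)) =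
      if l = p - 1 then -1 else 0 := by
    intro l hl
    have hl := Finset.mem_Ioo.1 hl
    have := FiniteField.sum_pow_units (ZMod p) (p - l - 1)
    rw [ZMod.card] at this
    rw [this]
    refine if_congr ⟨fun h => ?_, fun h => ?_⟩ rfl rfl
    · by_contra h'
      exact absurd (Nat.le_of_dvd (by omega) h) (by omega)
    · rw [h, show p - (p - 1) - 1 = 0 by omega]
      exact dvd_zero _
  rw [Finset.sum_congr rfl fun l hl => by rw [h4 l hl],
    Finset.sum_eq_single_of_mem (p - 1) (Finset.mem_Ioo.2 ⟨by omega, by omega⟩)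
      (fun l _ hl => by rw [if_neg hl, map_zero, zero_mul]), if_pos rfl,
    Nat.choose_symm (show 1 ≤ p by omega), show p - (p - 1) = 1 by omega, Nat.choose_one_right,
    Nat.div_self hp.pos] at h1
  have h5 := mem_redKer_of_C_mul_mem (by simp) h1
  convert h5 using 1
  rw [hF]
  push_cast
  ring

/-- In a suitable relation X^* Y^(p-1) L^*, expand the part of the power of L that is not a q-th
power. The leading monomial in Y gives exactly the twist; every other term has a Y-exponent already
excluded modulo q. -/
theorem frobTwist_orbitProd_mem (hδ : 2 ≤ δ) (hp3 : 3 ≤ p) (i b : ℕ) {j : ℕ} (hj : j + 1 < p) :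
    frobTwist p δ (X 0 ^ i * X 1 ^ j * orbitProd (ZMod p) p ^ b) ∈ redKer p δ := by
  have hp := (Fact.out : p.Prime)
  set N := orbitProd (ZMod p) p with hN
  have hq : p ^ (δ - 1) = p * p ^ (δ - 2) := by rw [← pow_succ']; congr 1; omega
  have hq' : 1 ≤ p ^ (δ - 2) := Nat.one_le_pow _ _ hp.pos
  set q' := p ^ (δ - 2)
  set q := p ^ (δ - 1) with hqd
  have hqpos : 3 ≤ q := hq ▸ hp3.trans (Nat.le_mul_of_pos_right p hq')
  obtain ⟨M, hM⟩ : ∃ M, (j + 1) * q' = M + 1 := ⟨(j + 1) * q' - 1, by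
    have := Nat.mul_le_mul (show 1 ≤ j + 1 by omega) hq'; omega⟩
  have hMq : M < q := by
    have := Nat.mul_lt_mul_of_pos_right hj hq'
    omega
  have hpM : (j + 1) * q = p * M + p := by
    calc (j + 1) * q = p * ((j + 1) * q') := by rw [hq]; ring
      _ = _ := by rw [hM]; ring
  -- The index j+1+pb is prime to p since 0 < j+1 < p. It makes the exponent of L equal to M + bq,
  -- and the X-exponent is set to q-1+iq.
  have h1 := orbitProd_pow_mem_redKer (δ := δ) hδ hp3 (b := j + 1 + p * b) (by
    intro h
    rw [Nat.dvd_add_left (Dvd.intro b rfl)] at h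
    exact absurd (Nat.le_of_dvd (by omega) h) (by omega)) (q - 2 + i * q)
  rw [show (j + 1 + p * b) * q' - 1 = M + b * q by
    have : (j + 1 + p * b) * q' = M + 1 + b * q := by rw [add_mul, hM, hq]; ring
    omega, show q - 2 + i * q + 1 = q - 1 + i * q by omega, ← hN] at h1
  have hNM : N ^ M = X 1 ^ M * ∑ m ∈ Finset.range (M + 1),
      (-X 0 ^ (p - 1)) ^ m * (X 1 ^ (p - 1)) ^ (M - m) *
        ((M.choose m : ℕ) : MvPolynomial (Fin 2) (ZMod p)) := by
    rw [← add_pow, ← mul_pow, hN, orbitProd]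
    congr 1
    rw [← pow_sub_one_mul hp.ne_zero (X 1)]
    ring
  rw [pow_add N, hNM, Finset.sum_range_succ', pow_mul N] at h1
  have h2 : ∀ m ∈ Finset.range M, X 0 ^ (q - 1 + i * q) * X 1 ^ (p - 1) * (X 1 ^ M *
      ((-X 0 ^ (p - 1)) ^ (m + 1) * (X 1 ^ (p - 1)) ^ (M - (m + 1)) *
        ((M.choose (m + 1) : ℕ) : MvPolynomial (Fin 2) (ZMod p)))) * (N ^ b) ^ q ∈ redKer p δ := by
    intro m hm
    have hm := Finset.mem_range.1 hm
    have h3 := C_mul_mem_redKer (X_pow_mul_X_pow_mul_pow_mem_redKer (δ := δ) hp3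
      (i := q - 1 + i * q + (p - 1) * (m + 1)) (j := p - 1 + M + (p - 1) * (M - (m + 1)))
      (by omega) (by
        rw [← hqd]
        intro h
        -- The Y-exponent plus one and (p-1)(m+1) add up to (j+1)q. As p-1 is prime to q,
        -- divisibility by q would force q ∣ m+1, although 0 < m+1 ≤ M < q.
        have e : p - 1 + M + (p - 1) * (M - (m + 1)) + 1 + (p - 1) * (m + 1) = (j + 1) * q := by
          rw [hpM]
          have : (p - 1) * (M - (m + 1)) + (p - 1) * (m + 1) = (p - 1) * M := by
            rw [← mul_add]; congr 1; omega
          have h' : (p - 1) * M + M = p * M := by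
            rw [← Nat.succ_mul]; congr 1; omega
          omega
        have h5 : q ∣ (p - 1) * (m + 1) := (Nat.dvd_add_right h).1 (e ▸ Dvd.intro_left _ rfl)
        have hcop : q.Coprime (p - 1) := by
          rw [hqd]
          refine Nat.Coprime.pow_left _ ((hp.coprime_iff_not_dvd).2 fun h6 => ?_)
          exact absurd (Nat.le_of_dvd (by omega) h6) (by omega)
        have h7 := Nat.le_of_dvd (by omega) (hcop.dvd_of_dvd_mul_left h5)
        omega) (N ^ b)) (((-1) ^ (m + 1) : ZMod p) * (M.choose (m + 1) : ℕ))
    convert h3 using 1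
    rw [neg_pow, pow_add (X 0), pow_add (X 1), pow_add (X 1), pow_mul, pow_mul]
    simp only [map_mul, map_pow, map_neg, map_one, map_natCast]
    ring
  have h3 := (redKer p δ).sub_mem h1 ((redKer p δ).sum_mem h2)
  rw [← Finset.sum_mul, ← Finset.mul_sum, ← Finset.mul_sum] at h3
  convert h3 using 1
  rw [frobTwist_apply, ← hqd, mul_pow, mul_pow, mul_pow, ← pow_mul, ← pow_mul]
  have e1 : (X 1 : MvPolynomial (Fin 2) (ZMod p)) ^ (q - 1) * X 1 ^ (j * q) =
      X 1 ^ (p - 1) * X 1 ^ M * (X 1 ^ (p - 1)) ^ M := by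
    rw [← pow_mul, ← pow_add, ← pow_add, ← pow_add]
    congr 1
    have h' : (p - 1) * M + M = p * M := by
      rw [← Nat.succ_mul]; congr 1; omega
    rw [add_mul] at hpM
    omega
  rw [pow_add (X 0)]
  simp only [pow_zero, one_mul, Nat.sub_zero, Nat.choose_zero_right, Nat.cast_one, mul_one]
  linear_combination (X 0 ^ (q - 1) * X 0 ^ (i * q) * (N ^ b) ^ q) * e1

end

section

/-! ### Generation of `p^(δ-1) M_G` -/

variable {p δ : ℕ}

theorem X_mul_orbitProd {R : Type*} [CommRing R] (hp : 1 ≤ p) :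
    X 0 * orbitProd R p = - dickson₁ R p := by
  rw [orbitProd, dickson₁, ← pow_sub_one_mul (by omega : p ≠ 0) (X 0)]
  ring

/-- The Dickson algebra over `ℤ/p`. -/
noncomputable abbrev dicksonAlg (p : ℕ) : Subalgebra (ZMod p) (MvPolynomial (Fin 2) (ZMod p)) :=
  Algebra.adjoin (ZMod p) {dickson₁ (ZMod p) p, dickson₂ (ZMod p) p}

theorem dickson₁_mem : dickson₁ (ZMod p) p ∈ dicksonAlg p := Algebra.subset_adjoin (Or.inl rfl)

theorem dickson₂_mem : dickson₂ (ZMod p) p ∈ dicksonAlg p := Algebra.subset_adjoin (Or.inr rfl)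

theorem red_f₁ [NeZero δ] : red p δ (f₁ p δ) = dickson₁ (ZMod p) p ^ p ^ (δ - 1) := by
  rw [f₁, map_pow, red, map_dickson₁]

theorem red_f₂ [NeZero δ] : red p δ (f₂ p δ) = dickson₂ (ZMod p) p ^ p ^ (δ - 1) := by
  rw [f₂, map_pow, red, map_dickson₂]

variable [Fact p.Prime]

/-- After multiplication by d₁, both sides become X^(p²) Y - X Y^(p²), by X·L = -d₁ and the
Frobenius expansion of L^p. -/
theorem dickson₂_eq_orbitProd : dickson₂ (ZMod p) p =
    X 0 ^ ((p - 1) * p) + orbitProd (ZMod p) p ^ (p - 1) := by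
  have hp := (Fact.out : p.Prime)
  apply mul_left_cancel₀ (dickson₁_ne_zero p)
  rw [dickson₁_mul_dickson₂ _ _ hp.one_le, mul_add]
  have h1 := X_mul_orbitProd (R := ZMod p) hp.one_le
  have h2 : orbitProd (ZMod p) p ^ (p - 1) * orbitProd (ZMod p) p =
      X 1 ^ p ^ 2 - X 0 ^ ((p - 1) * p) * X 1 ^ p := by
    rw [pow_sub_one_mul hp.ne_zero, orbitProd, sub_pow_char, mul_pow, ← pow_mul, ← pow_mul, sq]
  have h3 : (X 0 : MvPolynomial (Fin 2) (ZMod p)) ^ p ^ 2 = X 0 ^ ((p - 1) * p) * X 0 ^ p := by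
    rw [← pow_add]
    congr 1
    have : (p - 1) * p + 1 * p = p * p := by rw [← add_mul]; congr 1; have := hp.one_le; omega
    rw [sq]; omega
  have h4 : orbitProd (ZMod p) p = X 1 ^ p - X 0 ^ (p - 1) * X 1 := rfl
  have h5 : (X 0 : MvPolynomial (Fin 2) (ZMod p)) ^ p = X 0 ^ (p - 1) * X 0 :=
    (pow_sub_one_mul hp.ne_zero _).symm
  rw [h4] at h1
  rw [h3]
  linear_combination X 0 * h2 + X 0 ^ ((p - 1) * p) * X 1 * h5 - X 0 ^ ((p - 1) * p) * h1 -
    orbitProd (ZMod p) p ^ (p - 1) * X_mul_orbitProd (R := ZMod p) hp.one_le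

variable [NeZero δ]

/-- The q-th power map is a ring endomorphism fixing the scalars F_p, and it sends the Dickson
generators to the reductions of f₁ and f₂. -/
theorem exists_red_eq_pow {F : MvPolynomial (Fin 2) (ZMod p)} (hF : F ∈ dicksonAlg p) :
    ∃ a ∈ dicksonRing p δ, red p δ a = F ^ p ^ (δ - 1) := by
  induction hF using Algebra.adjoin_induction with
  | mem x hx =>
    rcases hx with rfl | rfl
    · exact ⟨_, Algebra.subset_adjoin (Or.inl rfl), red_f₁⟩
    · exact ⟨_, Algebra.subset_adjoin (Or.inr rfl), red_f₂⟩
  | algebraMap r =>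
    obtain ⟨s, hs⟩ := redHom_surjective (δ := δ) r
    refine ⟨C s, (dicksonRing p δ).algebraMap_mem s, ?_⟩
    rw [red_C, hs, algebraMap_eq, ← map_pow, ZMod.pow_card_pow]
  | add x y _ _ hx hy =>
    obtain ⟨a, ha, ha'⟩ := hx
    obtain ⟨b, hb, hb'⟩ := hy
    exact ⟨a + b, add_mem ha hb, by rw [map_add, ha', hb', add_pow_char_pow]⟩
  | mul x y _ _ hx hy =>
    obtain ⟨a, ha, ha'⟩ := hx
    obtain ⟨b, hb, hb'⟩ := hy
    exact ⟨a * b, mul_mem ha hb, by rw [map_mul, ha', hb', mul_pow]⟩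

theorem pow_mul_mem_redKer {F P : MvPolynomial (Fin 2) (ZMod p)} (hF : F ∈ dicksonAlg p)
    (hP : P ∈ redKer p δ) : F ^ p ^ (δ - 1) * P ∈ redKer p δ := by
  obtain ⟨a, ha, ha'⟩ := exists_red_eq_pow (δ := δ) hF
  obtain ⟨P, rfl⟩ := red_surjective (δ := δ) P
  rw [← ha', ← map_mul, mem_redKer_iff]
  exact mul_mem_torsionKer ha (mem_redKer_iff.1 hP)

/-- The polynomials `Q` such that `(XY)^(q-1) Q^q` is the reduction of a polynomial whose class is
killed by `p^(δ-1)`. -/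
noncomputable def twistKer (p δ : ℕ) [NeZero δ] [Fact p.Prime] :
    Submodule (dicksonAlg p) (MvPolynomial (Fin 2) (ZMod p)) :=
  { (redKer p δ).comap (frobTwist p δ) with
    smul_mem' := fun F Q hQ => by
      change frobTwist p δ ((F : MvPolynomial (Fin 2) (ZMod p)) * Q) ∈ redKer p δ
      have := pow_mul_mem_redKer F.2 (show frobTwist p δ Q ∈ redKer p δ from hQ)
      rw [frobTwist_apply] at this ⊢
      rwa [mul_pow _ Q, mul_left_comm] }

theorem mem_twistKer {Q : MvPolynomial (Fin 2) (ZMod p)} :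
    Q ∈ twistKer p δ ↔ frobTwist p δ Q ∈ redKer p δ := Iff.rfl

theorem mul_mem_of_mem_dicksonAlg (W : Submodule (dicksonAlg p) (MvPolynomial (Fin 2) (ZMod p)))
    {F Q : MvPolynomial (Fin 2) (ZMod p)} (hF : F ∈ dicksonAlg p) (hQ : Q ∈ W) : F * Q ∈ W :=
  W.smul_mem ⟨F, hF⟩ hQ

theorem C_mem_dicksonAlg (c : ZMod p) : C c ∈ dicksonAlg p := (dicksonAlg p).algebraMap_mem c

/-- The generators of the image: `twistKer` together with `X^(p²-p) Y^(p-1)`. -/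
noncomputable def twistGen (p δ : ℕ) [NeZero δ] [Fact p.Prime] :
    Submodule (dicksonAlg p) (MvPolynomial (Fin 2) (ZMod p)) :=
  twistKer p δ ⊔ Submodule.span _ {X 0 ^ ((p - 1) * p) * X 1 ^ (p - 1)}

theorem X_pow_mul_orbitProd_pow_mem (hδ : 2 ≤ δ) (hp3 : 3 ≤ p) (i b : ℕ) {j : ℕ} (hj : j + 1 < p) :
    X 0 ^ i * X 1 ^ j * orbitProd (ZMod p) p ^ b ∈ twistKer p δ :=
  frobTwist_orbitProd_mem hδ hp3 i b hj

theorem even_pow_sub_one (hp3 : 3 ≤ p) (n : ℕ) : Even (p ^ n - 1) :=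
  Nat.Odd.sub_odd (((Fact.out : p.Prime).odd_of_ne_two (by omega)).pow) odd_one

/-- The Weyl element sends XY to -XY, and the exponent q-1 is even, so it commutes with the twist.
-/
theorem subst_weyl_mem (hp3 : 3 ≤ p) {Q : MvPolynomial (Fin 2) (ZMod p)} (hQ : Q ∈ twistKer p δ) :
    subst (weyl (ZMod p)) Q ∈ twistKer p δ := by
  have h := (redKer p δ).add_mem (subst_sub_mem_redKer (δ := δ) (weyl (ZMod p))
    (frobTwist p δ Q)) hQ
  rw [sub_add_cancel, frobTwist_apply, map_mul, map_pow, map_pow, map_mul, subst_weyl_X0,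
    subst_weyl_X1, mul_neg, (even_pow_sub_one hp3 _).neg_pow, mul_comm (X 1)] at h
  exact h

theorem subst_torus_sub_mem (a : (ZMod p)ˣ) (Q : MvPolynomial (Fin 2) (ZMod p)) :
    subst (torus a) Q - Q ∈ twistKer p δ := by
  have h := subst_sub_mem_redKer (δ := δ) (torus a) (frobTwist p δ Q)
  have h1 : (C (a : ZMod p) * X 0 * (C (↑a⁻¹ : ZMod p) * X 1) : MvPolynomial (Fin 2) (ZMod p)) =
      X 0 * X 1 := by
    rw [mul_mul_mul_comm, ← map_mul, Units.mul_inv, map_one, one_mul]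
  rw [frobTwist_apply, map_mul, map_pow, map_pow, map_mul, subst_torus_X0, subst_torus_X1, h1] at h
  rw [mem_twistKer, map_sub]
  exact h

/-- `X^((p-1)s) Y^(p-1)` for small `s`. -/
theorem X_pow_mul_mem_of_lt (hδ : 2 ≤ δ) (hp3 : 3 ≤ p) {s : ℕ} (hs : s < p) :
    X 0 ^ ((p - 1) * s) * X 1 ^ (p - 1) ∈ twistKer p δ := by
  have hp := (Fact.out : p.Prime)
  have h1 : X 1 ^ ((p - 1) * (s + 1)) ∈ twistKer p δ := by
    have := subst_weyl_mem hp3 (X_pow_mul_orbitProd_pow_mem (δ := δ) hδ hp3 ((p - 1) * (s + 1)) 0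
      (j := 0) (by omega))
    simpa using this
  -- Rewrite in powers of L through Y^p = L + X^(p-1) Y. The term without L is the wanted monomial;
  -- a term with L^(c+1) has Y-exponent p-2-c < p-1 and is already known.
  have h2 : (X 1 : MvPolynomial (Fin 2) (ZMod p)) ^ ((p - 1) * (s + 1)) =
      X 1 ^ (p - (s + 1)) * (orbitProd (ZMod p) p + X 0 ^ (p - 1) * X 1) ^ s := by
    have : orbitProd (ZMod p) p + X 0 ^ (p - 1) * X 1 = X 1 ^ p := by rw [orbitProd]; ring
    rw [this, ← pow_mul, ← pow_add]
    congr 1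
    have : (p - 1) * (s + 1) + (s + 1) = p * (s + 1) := by rw [← Nat.succ_mul]; congr 1; omega
    rw [mul_add p] at this
    omega
  rw [h2, add_pow, Finset.sum_range_succ', mul_add] at h1
  have h3 : X 1 ^ (p - (s + 1)) * ∑ c ∈ Finset.range s, orbitProd (ZMod p) p ^ (c + 1) *
      (X 0 ^ (p - 1) * X 1) ^ (s - (c + 1)) * ((s.choose (c + 1) : ℕ) :
        MvPolynomial (Fin 2) (ZMod p)) ∈ twistKer p δ := by
    rw [Finset.mul_sum]
    refine Submodule.sum_mem _ fun c hc => ?_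
    have hc := Finset.mem_range.1 hc
    have h4 := mul_mem_of_mem_dicksonAlg _ (C_mem_dicksonAlg ((s.choose (c + 1) : ℕ) : ZMod p))
      (X_pow_mul_orbitProd_pow_mem (δ := δ) hδ hp3 ((p - 1) * (s - (c + 1))) (c + 1)
      (j := p - (s + 1) + (s - (c + 1))) (by omega))
    convert h4 using 1
    rw [pow_add (X 1), pow_mul, mul_pow, map_natCast]
    ring
  have h5 := (twistKer p δ).sub_mem h1 h3
  rw [add_sub_cancel_left] at h5
  convert h5 using 1
  simp only [pow_zero, one_mul, Nat.sub_zero, Nat.choose_zero_right, Nat.cast_one, mul_one]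
  rw [mul_pow, mul_left_comm, ← pow_add, ← pow_mul]
  congr 2
  omega

/-- Strong induction with d₂ = X^((p-1)p) + L^(p-1) and (XL)^(p-1) = d₁^(p-1): an exponent s > p is
traded for s-p and s-p-1, with Dickson coefficients. The value s = p is the extra generator. -/
theorem X_pow_mul_mem_twistGen (hδ : 2 ≤ δ) (hp3 : 3 ≤ p) (s : ℕ) :
    X 0 ^ ((p - 1) * s) * X 1 ^ (p - 1) ∈ twistGen p δ := by
  induction s using Nat.strong_induction_on with
  | _ s ih =>
    rcases lt_trichotomy s p with h | rfl | h
    · exact Submodule.mem_sup_left (X_pow_mul_mem_of_lt hδ hp3 h)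
    · exact Submodule.mem_sup_right (Submodule.mem_span_singleton_self _)
    · obtain ⟨u, rfl⟩ : ∃ u, s = p + (u + 1) := ⟨s - p - 1, by omega⟩
      have h1 := mul_mem_of_mem_dicksonAlg _ dickson₂_mem (ih (u + 1) (by omega))
      have h2 := mul_mem_of_mem_dicksonAlg _ (pow_mem dickson₁_mem (p - 1)) (ih u (by omega))
      have h3 := Submodule.sub_mem _ h1 h2
      convert h3 using 1
      have hev : Even (p - 1) := by simpa using even_pow_sub_one hp3 1
      rw [← hev.neg_pow (dickson₁ (ZMod p) p), ← X_mul_orbitProd (by omega),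
        dickson₂_eq_orbitProd, mul_pow, mul_add (p - 1), mul_add (p - 1) u, pow_add, pow_add]
      ring

theorem X_pow_mul_orbitProd_pow_mul_mem (hδ : 2 ≤ δ) (hp3 : 3 ≤ p) (u s : ℕ) :
    X 0 ^ ((p - 1) * s) * X 1 ^ (p - 1) * orbitProd (ZMod p) p ^ ((p - 1) * u) ∈ twistGen p δ := by
  induction u generalizing s with
  | zero => simpa using X_pow_mul_mem_twistGen hδ hp3 s
  | succ u ih =>
    have h3 := Submodule.sub_mem _ (mul_mem_of_mem_dicksonAlg _ dickson₂_mem (ih s)) (ih (s + p))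
    convert h3 using 1
    rw [dickson₂_eq_orbitProd, mul_add (p - 1) u, mul_add (p - 1) s, pow_add, pow_add]
    ring

/-- The torus scales this element by a^(i-b). If that is a nontrivial character, the element lies in
`twistKer`. Otherwise p-1 divides i-b, and powers of X·L = -d₁ factor out, leaving a pure power of X
or of L. -/
theorem X_pow_mul_orbitProd_pow_top_mem (hδ : 2 ≤ δ) (hp3 : 3 ≤ p) (i b : ℕ) :
    X 0 ^ i * X 1 ^ (p - 1) * orbitProd (ZMod p) p ^ b ∈ twistGen p δ := by
  have hp := (Fact.out : p.Prime)
  by_cases hab : ∀ a : (ZMod p)ˣ, a ^ i = a ^ b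
  · rcases le_total b i with h | h
    · obtain ⟨e, rfl⟩ := Nat.exists_eq_add_of_le h
      have : p - 1 ∣ e := by
        have := (FiniteField.forall_pow_eq_one_iff (ZMod p) e).1 fun a => by
          have := hab a
          rwa [pow_add, mul_eq_left] at this
        rwa [ZMod.card] at this
      obtain ⟨s, rfl⟩ := this
      have h1 := mul_mem_of_mem_dicksonAlg _ (pow_mem (neg_mem dickson₁_mem) b)
        (X_pow_mul_mem_twistGen (δ := δ) hδ hp3 s)
      convert h1 using 1
      rw [← X_mul_orbitProd (by omega), mul_pow, pow_add]
      ring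
    · obtain ⟨e, rfl⟩ := Nat.exists_eq_add_of_le h
      have : p - 1 ∣ e := by
        have := (FiniteField.forall_pow_eq_one_iff (ZMod p) e).1 fun a => by
          have := (hab a).symm
          rwa [pow_add, mul_eq_left] at this
        rwa [ZMod.card] at this
      obtain ⟨u, rfl⟩ := this
      have h1 := mul_mem_of_mem_dicksonAlg _ (pow_mem (neg_mem dickson₁_mem) i)
        (X_pow_mul_orbitProd_pow_mul_mem (δ := δ) hδ hp3 u 0)
      convert h1 using 1
      rw [← X_mul_orbitProd (by omega), mul_pow, pow_add, mul_zero, pow_zero]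
      ring
  · push Not at hab
    obtain ⟨a, ha⟩ := hab
    apply Submodule.mem_sup_left
    have ha1 : ∀ a : (ZMod p)ˣ, (a : ZMod p) ^ (p - 1) = 1 := fun a => by
      rw [← Units.val_pow_eq_pow_val, ZMod.units_pow_card_sub_one_eq_one, Units.val_one]
    have h1 := subst_torus_sub_mem (δ := δ) a
      (X 0 ^ i * X 1 ^ (p - 1) * orbitProd (ZMod p) p ^ b)
    have hN : subst (torus a) (orbitProd (ZMod p) p) = C (↑a⁻¹ : ZMod p) * orbitProd (ZMod p) p := by
      have e1 : (C (↑a⁻¹ : ZMod p) : MvPolynomial (Fin 2) (ZMod p)) ^ p = C (↑a⁻¹ : ZMod p) := by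
        rw [← map_pow, ZMod.pow_card]
      have e2 : (C (a : ZMod p) : MvPolynomial (Fin 2) (ZMod p)) ^ (p - 1) = 1 := by
        rw [← map_pow, ha1 a, map_one]
      rw [orbitProd, map_sub, map_mul, map_pow, map_pow, subst_torus_X0, subst_torus_X1, mul_pow,
        mul_pow, e1, e2]
      ring
    have e3 : (C (↑a⁻¹ : ZMod p) : MvPolynomial (Fin 2) (ZMod p)) ^ (p - 1) = 1 := by
      rw [← map_pow, ha1, map_one]
    rw [map_mul, map_mul, map_pow, map_pow, map_pow, subst_torus_X0, subst_torus_X1, hN, mul_pow,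
      mul_pow, mul_pow, e3] at h1
    have hc : ((a : ZMod p) ^ i * (↑a⁻¹ : ZMod p) ^ b - 1) ≠ 0 := by
      intro h
      apply ha
      rw [sub_eq_zero] at h
      have h' : a ^ i * a⁻¹ ^ b = 1 := Units.ext (by
        rw [Units.val_mul, Units.val_pow_eq_pow_val, Units.val_pow_eq_pow_val, Units.val_one]
        exact h)
      rwa [inv_pow, mul_inv_eq_one] at h'
    have h2 := mul_mem_of_mem_dicksonAlg _
      (C_mem_dicksonAlg ((a : ZMod p) ^ i * (↑a⁻¹ : ZMod p) ^ b - 1)⁻¹) h1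
    convert h2 using 1
    have e4 : (C ((a : ZMod p) ^ i * (↑a⁻¹ : ZMod p) ^ b - 1)⁻¹ : MvPolynomial (Fin 2) (ZMod p)) *
        (C (a : ZMod p) ^ i * C (↑a⁻¹ : ZMod p) ^ b - 1) = 1 := by
      rw [← map_pow, ← map_pow, ← map_mul, ← map_one C, ← map_sub, ← map_mul, inv_mul_cancel₀ hc]
    linear_combination (-(X 0 ^ i * X 1 ^ (p - 1) * orbitProd (ZMod p) p ^ b)) * e4

/-- Since L is monic of degree p in Y, replacing Y^p by L + X^(p-1) Y lowers the Y-exponent below p.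
-/
theorem mem_twistGen (hδ : 2 ≤ δ) (hp3 : 3 ≤ p) (Q : MvPolynomial (Fin 2) (ZMod p)) :
    Q ∈ twistGen p δ := by
  have key : ∀ j i b, X 0 ^ i * X 1 ^ j * orbitProd (ZMod p) p ^ b ∈ twistGen p δ := by
    intro j
    induction j using Nat.strong_induction_on with
    | _ j ih =>
      intro i b
      rcases Nat.lt_or_ge j p with h | h
      · rcases Nat.lt_or_ge (j + 1) p with h1 | h1
        · exact Submodule.mem_sup_left (X_pow_mul_orbitProd_pow_mem hδ hp3 i b h1)
        · obtain rfl : j = p - 1 := by omega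
          exact X_pow_mul_orbitProd_pow_top_mem hδ hp3 i b
      · obtain ⟨e, rfl⟩ := Nat.exists_eq_add_of_le h
        have h1 := Submodule.add_mem _ (ih e (by omega) i (b + 1))
          (ih (e + 1) (by omega) (i + (p - 1)) b)
        convert h1 using 1
        rw [pow_add _ p, pow_add _ b, pow_add _ i, pow_one]
        nth_rewrite 3 [orbitProd]
        ring
  refine mem_of_C_mul_X_pow_mul_X_pow_mem (twistGen p δ).toAddSubgroup (fun c i j => ?_) Q
  have := mul_mem_of_mem_dicksonAlg _ (C_mem_dicksonAlg c) (key j i 0)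
  simpa using this

theorem exists_frobTwist_sub_mem (hp3 : 3 ≤ p) (hδ : 2 ≤ δ) (P : MvPolynomial (Fin 2) (ZMod p)) :
    ∃ Q, P - C (constantCoeff P) - frobTwist p δ Q ∈ redKer p δ := by
  have hp := (Fact.out : p.Prime)
  have hq : 1 < p ^ (δ - 1) := Nat.one_lt_pow (by omega) (by omega)
  induction P using MvPolynomial.induction_on' with
  | monomial u a =>
    rw [show monomial u a = C a * (X 0 ^ u 0 * X 1 ^ u 1) by
      rw [monomial_eq, Finsupp.prod_fintype _ _ (by simp), Fin.prod_univ_two]]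
    generalize u 0 = i, u 1 = j
    by_cases h0 : i = 0 ∧ j = 0
    · obtain ⟨rfl, rfl⟩ := h0
      exact ⟨0, by simp⟩
    have hcc : constantCoeff (C a * (X 0 ^ i * X 1 ^ j) : MvPolynomial (Fin 2) (ZMod p)) = 0 := by
      simp only [map_mul, map_pow, constantCoeff_X]
      rcases Nat.eq_zero_or_pos i with hi | hi
      · rw [zero_pow (n := j) (fun h => h0 ⟨hi, h⟩), mul_zero, mul_zero]
      · rw [zero_pow (n := i) (by omega), zero_mul, mul_zero]
    rw [hcc, map_zero, sub_zero]
    by_cases hij : p ^ (δ - 1) ∣ i + 1 ∧ p ^ (δ - 1) ∣ j + 1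
    · obtain ⟨⟨i', hi'⟩, ⟨j', hj'⟩⟩ := hij
      obtain ⟨i', rfl⟩ : ∃ n, i' = n + 1 := ⟨i' - 1, by
        rcases i' with _ | i' <;> simp at hi' ⊢⟩
      obtain ⟨j', rfl⟩ : ∃ n, j' = n + 1 := ⟨j' - 1, by
        rcases j' with _ | j' <;> simp at hj' ⊢⟩
      refine ⟨C a * (X 0 ^ i' * X 1 ^ j'), ?_⟩
      have : C a * (X 0 ^ i * X 1 ^ j) = frobTwist p δ (C a * (X 0 ^ i' * X 1 ^ j')) := by
        rw [frobTwist_apply, mul_pow (C a), ← map_pow, ZMod.pow_card_pow,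
          show i = p ^ (δ - 1) - 1 + i' * p ^ (δ - 1) by rw [mul_add, mul_comm _ i'] at hi'; omega,
          show j = p ^ (δ - 1) - 1 + j' * p ^ (δ - 1) by rw [mul_add, mul_comm _ j'] at hj'; omega,
          pow_add, pow_add, pow_mul, pow_mul]
        ring
      rw [this, sub_self]
      exact zero_mem _
    · refine ⟨0, ?_⟩
      rw [map_zero, sub_zero]
      apply C_mul_mem_redKer
      -- Here q > 1 is needed, hence δ ≥ 2: pure powers of X or Y then fail the divisibility test
      -- and vanish.
      have h1 : ¬ p ^ (δ - 1) ∣ 0 + 1 := fun h => by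
        have := Nat.le_of_dvd (by omega) h
        omega
      rcases Nat.eq_zero_or_pos i with rfl | hi
      · exact X_pow_mul_X_pow_mem_redKer' hp3 (by omega) h1
      rcases Nat.eq_zero_or_pos j with rfl | hj
      · exact X_pow_mul_X_pow_mem_redKer hp3 hi h1
      by_cases hi' : p ^ (δ - 1) ∣ i + 1
      · exact X_pow_mul_X_pow_mem_redKer hp3 hi fun h => hij ⟨hi', h⟩
      · exact X_pow_mul_X_pow_mem_redKer' hp3 hj hi'
  | add P P' hP hP' =>
    obtain ⟨Q, hQ⟩ := hP
    obtain ⟨Q', hQ'⟩ := hP'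
    refine ⟨Q + Q', ?_⟩
    have := (redKer p δ).add_mem hQ hQ'
    convert this using 1
    rw [map_add, map_add, map_add]
    ring

/-- The monomial whose class is `topClass`. -/
noncomputable def topMono (p δ : ℕ) : MvPolynomial (Fin 2) (ZMod (p ^ δ)) :=
  X 0 ^ (p ^ (δ + 1) - p ^ δ + p ^ (δ - 1) - 1) * X 1 ^ (p ^ δ - 1)

/-- The exponents are q-1 + (p-1)p·q and q-1 + (p-1)·q; this explains the shape of the class U. -/
theorem red_topMono : red p δ (topMono p δ) =
    frobTwist p δ (X 0 ^ ((p - 1) * p) * X 1 ^ (p - 1)) := by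
  have hp := (Fact.out : p.Prime)
  have hq : 1 ≤ p ^ (δ - 1) := Nat.one_le_pow _ _ hp.pos
  obtain ⟨e, rfl⟩ : ∃ e, δ = e + 1 := ⟨δ - 1, by have := NeZero.pos δ; omega⟩
  rw [Nat.add_sub_cancel] at hq
  rw [topMono, frobTwist_apply, map_mul, map_pow, map_pow, red_X, red_X, mul_pow, mul_pow,
    ← pow_mul, ← pow_mul, mul_mul_mul_comm, ← pow_add, ← pow_add, Nat.add_sub_cancel]
  obtain ⟨r, rfl⟩ : ∃ r, p = r + 1 := ⟨p - 1, by have := hp.one_le; omega⟩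
  rw [Nat.add_sub_cancel]
  congr 2
  · have : (r + 1) ^ (e + 1 + 1) = (r + 1) ^ (e + 1) + r * (r + 1) * (r + 1) ^ e := by ring
    omega
  · have : (r + 1) ^ (e + 1) = (r + 1) ^ e + r * (r + 1) ^ e := by ring
    omega

/-- `p^(δ-1) M_G` is generated by the class of `1` and the multiples of `topClass`. -/
theorem exists_sub_mem_torsionKer (hδ : 2 ≤ δ) (hp3 : 3 ≤ p)
    (P : MvPolynomial (Fin 2) (ZMod (p ^ δ))) :
    ∃ a ∈ dicksonRing p δ, P - C (constantCoeff P) - a * topMono p δ ∈ torsionKer p δ := by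
  obtain ⟨Q, hQ⟩ := exists_frobTwist_sub_mem (δ := δ) hp3 hδ (red p δ P)
  obtain ⟨T, hT, V, hV, hTV⟩ := Submodule.mem_sup.1 (mem_twistGen (δ := δ) hδ hp3 Q)
  obtain ⟨⟨F, hF⟩, rfl⟩ := Submodule.mem_span_singleton.1 hV
  obtain ⟨a, ha, ha'⟩ := exists_red_eq_pow (δ := δ) hF
  refine ⟨a, ha, ?_⟩
  rw [← mem_redKer_iff]
  have h1 := (redKer p δ).add_mem hQ hT
  convert h1 using 1
  rw [← hTV, map_add (frobTwist p δ), map_sub, map_sub, map_mul, ha', red_topMono, red_C]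
  have h2 : redHom p δ (constantCoeff P) = constantCoeff (red p δ P) := by
    rw [red, constantCoeff_map]
  rw [h2, Subalgebra.smul_def]
  simp only [frobTwist_apply, smul_eq_mul, mul_pow F]
  ring

end

section

/-! ### Invariant functionals -/

/-- The exponent of `X^i Y^j`. -/
noncomputable def expo (i j : ℕ) : Fin 2 →₀ ℕ := Finsupp.single 0 i + Finsupp.single 1 j

theorem expo_eq_iff {i j a b : ℕ} : expo i j = expo a b ↔ i = a ∧ j = b := by
  constructor
  · intro h
    have h0 := DFunLike.congr_fun h 0
    have h1 := DFunLike.congr_fun h 1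
    simp [expo] at h0 h1
    exact ⟨h0, h1⟩
  · rintro ⟨rfl, rfl⟩
    rfl

theorem expo_self (m : Fin 2 →₀ ℕ) : expo (m 0) (m 1) = m := by
  ext i
  fin_cases i <;> simp [expo]

theorem coeff_C_mul_X_pow_mul_X_pow {R : Type*} [CommRing R] (c : R) (i j a b : ℕ) :
    coeff (expo i j) (C c * (X 0 ^ a * X 1 ^ b) : MvPolynomial (Fin 2) R) =
      if a = i ∧ b = j then c else 0 := by
  classical
  rw [show (X 0 ^ a * X 1 ^ b : MvPolynomial (Fin 2) R) = monomial (expo a b) 1 by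
    rw [X_pow_eq_monomial, X_pow_eq_monomial, monomial_mul, one_mul]; rfl, C_mul_monomial, mul_one,
    coeff_monomial]
  exact if_congr expo_eq_iff rfl rfl

theorem coeff_X_pow_mul_X_pow {R : Type*} [CommRing R] (i j a b : ℕ) :
    coeff (expo i j) (X 0 ^ a * X 1 ^ b : MvPolynomial (Fin 2) R) =
      if a = i ∧ b = j then 1 else 0 := by
  simpa using coeff_C_mul_X_pow_mul_X_pow (1 : R) i j a b

theorem coeff_subst_of_monomial {R : Type*} [CommRing R]
    {g : Matrix.SpecialLinearGroup (Fin 2) R} {m m' : Fin 2 →₀ ℕ} {s : R}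
    (h : ∀ i j, coeff m (subst g (X 0 ^ i * X 1 ^ j)) = s * coeff m' (X 0 ^ i * X 1 ^ j))
    (P : MvPolynomial (Fin 2) R) : coeff m (subst g P) = s * coeff m' P :=
  mem_of_C_mul_X_pow_mul_X_pow_mem
    { carrier := {P | coeff m (subst g P) = s * coeff m' P}
      zero_mem' := by simp
      add_mem' := fun {a b} ha hb => by
        change _ = _ at ha hb ⊢
        rw [map_add, coeff_add, coeff_add, ha, hb, mul_add]
      neg_mem' := fun {a} ha => by
        change _ = _ at ha ⊢
        rw [map_neg, coeff_neg, coeff_neg, ha, mul_neg] }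
    (fun c i j => by
      change _ = _
      rw [map_mul, subst_C, coeff_C_mul, coeff_C_mul, h]
      ring) P

theorem subst_unip_mul {R : Type*} [CommRing R] (t : R) (i j : ℕ) :
    subst (unip t) (X 0 ^ i * X 1 ^ j) = ∑ l ∈ Finset.range (j + 1),
      C (t ^ (j - l) * (j.choose l : R)) * (X 0 ^ (i + (j - l)) * X 1 ^ l) := by
  rw [map_mul, map_pow, map_pow, subst_unip_X0, subst_unip_X1, add_pow, Finset.mul_sum]
  refine Finset.sum_congr rfl fun l _ => ?_
  rw [mul_pow, map_mul, map_pow, map_natCast, pow_add]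
  ring

/-- The lower unipotent matrix. -/
def lowerUnip {R : Type*} [CommRing R] (t : R) : Matrix.SpecialLinearGroup (Fin 2) R :=
  ⟨!![1, 0; t, 1], by simp⟩

theorem SL2_ext {R : Type*} [CommRing R] {g h : Matrix.SpecialLinearGroup (Fin 2) R}
    (h00 : g 0 0 = h 0 0) (h01 : g 0 1 = h 0 1) (h10 : g 1 0 = h 1 0) (h11 : g 1 1 = h 1 1) :
    g = h := by
  refine Matrix.SpecialLinearGroup.ext _ _ fun i j => ?_
  fin_cases i <;> fin_cases j <;> assumption

theorem SL2_det {R : Type*} [CommRing R] (g : Matrix.SpecialLinearGroup (Fin 2) R) :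
    g 0 0 * g 1 1 - g 0 1 * g 1 0 = 1 := by
  rw [← Matrix.det_fin_two]; exact g.det_coe

theorem lowerUnip_mul_weyl {R : Type*} [CommRing R] (t : R) :
    lowerUnip t * weyl R = weyl R * unip (-t) := by
  apply SL2_ext <;>
  simp only [Matrix.SpecialLinearGroup.coe_mul, Matrix.mul_apply, Fin.sum_univ_two] <;>
  simp [lowerUnip, weyl, unip]

theorem eq_lowerUnip_mul {R : Type*} [CommRing R] (g : Matrix.SpecialLinearGroup (Fin 2) R)
    (a : Rˣ) (ha : (a : R) = g 0 0) :
    g = lowerUnip (↑a⁻¹ * g 1 0) * (torus a * unip (↑a⁻¹ * g 0 1)) := by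
  have h1 : (a : R) * ↑a⁻¹ = 1 := Units.mul_inv a
  have hdet := SL2_det g
  apply SL2_ext <;>
  simp only [Matrix.SpecialLinearGroup.coe_mul, Matrix.mul_apply, Fin.sum_univ_two]
  · simp [lowerUnip, torus, unip, ha]
  · simp [lowerUnip, torus, unip]
  · simp [lowerUnip, torus, unip]
    linear_combination (-g 1 0) * h1
  · simp [lowerUnip, torus, unip]
    rw [← ha] at hdet
    linear_combination (-g 1 1) * h1 + (↑a⁻¹ : R) * hdet

variable {p δ : ℕ} [Fact p.Prime]

/-- Multiplying by a q-th power preserves exponents modulo q, and q-1 is the only value of m ≤ 2q-2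
congruent to -1. -/
theorem coeff_mul_pow {i j m n : ℕ} (hmn : m + n + 2 = 2 * p ^ (δ - 1))
    (G : MvPolynomial (Fin 2) (ZMod p)) :
    coeff (expo (p ^ (δ - 1) - 1 + i * p ^ (δ - 1)) (p ^ (δ - 1) - 1 + j * p ^ (δ - 1)))
      (X 0 ^ m * X 1 ^ n * G ^ p ^ (δ - 1)) =
      if m = p ^ (δ - 1) - 1 then coeff (expo i j) G else 0 := by
  have hq : 1 ≤ p ^ (δ - 1) := Nat.one_le_pow _ _ (Fact.out : p.Prime).pos
  set q := p ^ (δ - 1) with hqd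
  refine mem_of_C_mul_X_pow_mul_X_pow_mem
    { carrier := {G : MvPolynomial (Fin 2) (ZMod p) |
        coeff (expo (q - 1 + i * q) (q - 1 + j * q)) (X 0 ^ m * X 1 ^ n * G ^ q) =
          if m = q - 1 then coeff (expo i j) G else 0}
      zero_mem' := by
        change _ = _
        rw [zero_pow (by omega)]
        simp
      add_mem' := fun {a b} ha hb => by
        change _ = _ at ha hb ⊢
        rw [hqd, add_pow_char_pow, ← hqd, mul_add, coeff_add, ha, hb, coeff_add]
        split_ifs <;> simp
      neg_mem' := fun {a} ha => by
        change _ = _ at ha ⊢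
        have : (-a) ^ q = - a ^ q := by
          have := sub_pow_char_pow (p := p) (n := δ - 1) (x := 0) (y := a)
          rwa [← hqd, zero_pow (by omega), zero_sub, zero_sub] at this
        rw [this, mul_neg, coeff_neg, ha, coeff_neg]
        split_ifs <;> simp }
    (fun c a b => ?_) G
  change _ = _
  rw [mul_pow, ← map_pow, hqd, ZMod.pow_card_pow, ← hqd, mul_pow, ← pow_mul, ← pow_mul,
    mul_left_comm, mul_mul_mul_comm, ← pow_add, ← pow_add, coeff_C_mul_X_pow_mul_X_pow,
    coeff_C_mul_X_pow_mul_X_pow]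
  split_ifs with h1 h2 h3 h4 h5
  · rfl
  · exfalso
    apply h3
    refine ⟨?_, ?_⟩ <;> apply Nat.eq_of_mul_eq_mul_right hq <;> omega
  · exfalso
    obtain ⟨h1, h1'⟩ := h1
    apply h2
    rcases lt_trichotomy a i with h | h | h
    · have := Nat.mul_le_mul_right q (Nat.succ_le_of_lt h)
      rw [Nat.succ_mul] at this
      omega
    · subst h
      omega
    · have := Nat.mul_le_mul_right q (Nat.succ_le_of_lt h)
      rw [Nat.succ_mul] at this
      omega
  · exfalso
    obtain ⟨rfl, rfl⟩ := h5
    exact h1 ⟨by omega, by omega⟩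
  · rfl
  · rfl

/-- By the residue argument only the coefficient of (XY)^(q-1) in g(XY)^(q-1) matters. By the
geometric sum formula in characteristic p it is (bc - ad)^(q-1) = (-1)^(q-1) = 1. -/
theorem coeff_subst_frobTwist (hp3 : 3 ≤ p) (i j : ℕ)
    (g : Matrix.SpecialLinearGroup (Fin 2) (ZMod p)) (Q : MvPolynomial (Fin 2) (ZMod p)) :
    coeff (expo (p ^ (δ - 1) - 1 + i * p ^ (δ - 1)) (p ^ (δ - 1) - 1 + j * p ^ (δ - 1)))
      (subst g (frobTwist p δ Q)) = coeff (expo i j) (subst g Q) := by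
  have hq : 1 ≤ p ^ (δ - 1) := Nat.one_le_pow _ _ (Fact.out : p.Prime).pos
  have hlin : ∀ a c : ZMod p,
      (C a * X 0 + C c * X 1 : MvPolynomial (Fin 2) (ZMod p)) ^ (p ^ (δ - 1) - 1) =
      ∑ r ∈ Finset.range (p ^ (δ - 1)), C (a ^ r * (-c) ^ (p ^ (δ - 1) - 1 - r)) *
        (X 0 ^ r * X 1 ^ (p ^ (δ - 1) - 1 - r)) := by
    intro a c
    have := sub_pow_char_pow_sub_one (p := p) (δ - 1) (C a * X 0)
      (-(C c * X 1) : MvPolynomial (Fin 2) (ZMod p))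
    rw [sub_neg_eq_add] at this
    rw [this]
    refine Finset.sum_congr rfl fun r _ => ?_
    rw [← neg_mul, mul_pow, mul_pow, map_mul, map_pow, map_pow, map_neg]
    ring
  rw [frobTwist_apply, map_mul, map_pow, map_pow, map_mul, subst_X, subst_X, mul_pow, hlin, hlin,
    Finset.sum_mul_sum, Finset.sum_mul, coeff_sum]
  set G := subst g Q
  set q := p ^ (δ - 1) with hqd
  have hterm : ∀ r ∈ Finset.range q, coeff (expo (q - 1 + i * q) (q - 1 + j * q))
      ((∑ s ∈ Finset.range q, C (g 0 0 ^ r * (-g 1 0) ^ (q - 1 - r)) *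
        (X 0 ^ r * X 1 ^ (q - 1 - r)) * (C (g 0 1 ^ s * (-g 1 1) ^ (q - 1 - s)) *
        (X 0 ^ s * X 1 ^ (q - 1 - s)))) * G ^ q) =
      (-(g 0 0 * g 1 1)) ^ r * (-(g 0 1 * g 1 0)) ^ (q - 1 - r) * coeff (expo i j) G := by
    intro r hr
    have hr := Finset.mem_range.1 hr
    rw [Finset.sum_mul, coeff_sum]
    have h1 : ∀ s ∈ Finset.range q, coeff (expo (q - 1 + i * q) (q - 1 + j * q))
        (C (g 0 0 ^ r * (-g 1 0) ^ (q - 1 - r)) *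
        (X 0 ^ r * X 1 ^ (q - 1 - r)) * (C (g 0 1 ^ s * (-g 1 1) ^ (q - 1 - s)) *
        (X 0 ^ s * X 1 ^ (q - 1 - s))) * G ^ q) =
        if s = q - 1 - r then (-(g 0 0 * g 1 1)) ^ r * (-(g 0 1 * g 1 0)) ^ (q - 1 - r) *
          coeff (expo i j) G else 0 := by
      intro s hs
      have hs := Finset.mem_range.1 hs
      rw [mul_mul_mul_comm, ← map_mul, mul_assoc (C _), coeff_C_mul, mul_mul_mul_comm (X 0 ^ r),
        ← pow_add, ← pow_add, hqd, coeff_mul_pow (by omega), ← hqd, mul_ite, mul_zero]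
      by_cases h : s = q - 1 - r
      · rw [if_pos (by omega), if_pos h, h, show q - 1 - (q - 1 - r) = r by omega, neg_pow (g 1 0),
          neg_pow (g 1 1), neg_pow (g 0 0 * g 1 1), neg_pow (g 0 1 * g 1 0), mul_pow, mul_pow]
        ring
      · rw [if_neg (by omega), if_neg h]
    rw [Finset.sum_congr rfl h1, Finset.sum_ite_eq', if_pos (Finset.mem_range.2 (by omega))]
  rw [Finset.sum_congr rfl hterm, ← Finset.sum_mul, hqd,
    ← sub_pow_char_pow_sub_one, ← hqd,
    show -(g 0 0 * g 1 1) - -(g 0 1 * g 1 0) = -1 by linear_combination -(SL2_det g),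
    (even_pow_sub_one hp3 _).neg_one_pow, one_mul]

variable [NeZero δ]

/-- A monomial X^i Y^j with j > J would contribute a multiple of p^(j-J)·C(j, J), and p^δ divides
this because q divides J+1. -/
theorem coeff_subst_unip (hp3 : 3 ≤ p) (u : ZMod (p ^ δ)) {I J : ℕ} (hJ : p ^ (δ - 1) ∣ J + 1)
    (P : MvPolynomial (Fin 2) (ZMod (p ^ δ))) :
    coeff (expo I J) (subst (unip ((p : ZMod (p ^ δ)) * u)) P) = coeff (expo I J) P := by
  rw [← one_mul (coeff (expo I J) P)]
  refine coeff_subst_of_monomial (fun i j => ?_) P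
  rw [one_mul, subst_unip_mul, coeff_sum, Finset.sum_range_succ]
  simp only [coeff_C_mul_X_pow_mul_X_pow]
  rw [Finset.sum_eq_zero, zero_add, coeff_X_pow_mul_X_pow]
  · simp
  · intro l hl
    have hl := Finset.mem_range.1 hl
    refine ite_eq_right_iff.2 ?_
    rintro ⟨-, rfl⟩
    have h1 := pow_dvd_pow_mul_choose_of_dvd_sub (Fact.out : p.Prime) hp3 (r := δ - 1) (n := j)
      (l := j - l) (by omega) (by omega) (by rwa [show j - (j - l) = l by omega])
    rw [Nat.choose_symm hl.le, Nat.sub_add_cancel NeZero.one_le] at h1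
    have h2 := (ZMod.natCast_eq_zero_iff _ _).2 h1
    push_cast at h2
    rw [mul_pow]
    linear_combination u ^ (j - l) * h2

theorem coeff_subst_weyl {R : Type*} [CommRing R] (I J : ℕ) (P : MvPolynomial (Fin 2) R) :
    coeff (expo I J) (subst (weyl R) P) = (-1) ^ I * coeff (expo J I) P := by
  refine coeff_subst_of_monomial (fun i j => ?_) P
  rw [map_mul, map_pow, map_pow, subst_weyl_X0, subst_weyl_X1, neg_pow,
    show (X 1 ^ i * ((-1) ^ j * X 0 ^ j) : MvPolynomial (Fin 2) R)
      = C ((-1) ^ j) * (X 0 ^ j * X 1 ^ i) by simp; ring, coeff_C_mul_X_pow_mul_X_pow,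
      coeff_X_pow_mul_X_pow]
  by_cases h : j = I ∧ i = J
  · rw [if_pos h, if_pos h.symm, h.1, mul_one]
  · rw [if_neg h, if_neg fun h' => h h'.symm, mul_zero]

theorem coeff_subst_lowerUnip (hp3 : 3 ≤ p) (u : ZMod (p ^ δ)) {I J : ℕ}
    (hI : p ^ (δ - 1) ∣ I + 1) (P : MvPolynomial (Fin 2) (ZMod (p ^ δ))) :
    coeff (expo I J) (subst (lowerUnip ((p : ZMod (p ^ δ)) * u)) P) = coeff (expo I J) P := by
  obtain ⟨P, rfl⟩ : ∃ Q, P = subst (weyl _) Q := ⟨subst (weyl _)⁻¹ P, by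
    rw [← AlgHom.comp_apply, ← subst_mul, mul_inv_cancel, subst_one, AlgHom.id_apply]⟩
  rw [← AlgHom.comp_apply, ← subst_mul, lowerUnip_mul_weyl, subst_mul, AlgHom.comp_apply,
    coeff_subst_weyl, coeff_subst_weyl, ← mul_neg, coeff_subst_unip hp3 _ hI]

/-- A unit a ≡ 1 modulo p satisfies a^q = 1, so a^I = a⁻¹ = a^J and the two scalars cancel. -/
theorem coeff_subst_torus {a : (ZMod (p ^ δ))ˣ} (ha : redHom p δ a = 1) {I J : ℕ}
    (hI : p ^ (δ - 1) ∣ I + 1) (hJ : p ^ (δ - 1) ∣ J + 1)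
    (P : MvPolynomial (Fin 2) (ZMod (p ^ δ))) :
    coeff (expo I J) (subst (torus a) P) = coeff (expo I J) P := by
  have h1 : a ^ p ^ (δ - 1) = 1 := by
    apply Units.ext
    rw [Units.val_pow_eq_pow_val, Units.val_one]
    have h2 : (p : ZMod (p ^ δ)) ∣ (a : ZMod (p ^ δ)) - 1 := by
      rw [← redHom_eq_zero_iff, map_sub, ha, map_one, sub_self]
    have h3 := dvd_sub_pow_of_dvd_sub h2 (δ - 1)
    rwa [Nat.sub_add_cancel NeZero.one_le, natCast_pow_eq_zero, zero_dvd_iff, one_pow,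
      sub_eq_zero] at h3
  have h2 : ∀ n, p ^ (δ - 1) ∣ n + 1 → a ^ n = a⁻¹ := by
    rintro n ⟨k, hk⟩
    rw [eq_inv_iff_mul_eq_one, ← pow_succ, hk, pow_mul, h1, one_pow]
  rw [← one_mul (coeff (expo I J) P)]
  refine coeff_subst_of_monomial (fun i j => ?_) P
  rw [map_mul, map_pow, map_pow, subst_torus_X0, subst_torus_X1, mul_pow, mul_pow,
    mul_mul_mul_comm, ← map_pow, ← map_pow, ← map_mul, coeff_C_mul_X_pow_mul_X_pow,
    coeff_X_pow_mul_X_pow, one_mul]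
  refine ite_congr rfl ?_ fun _ => rfl
  rintro ⟨rfl, rfl⟩
  rw [← Units.val_pow_eq_pow_val, ← Units.val_pow_eq_pow_val, ← Units.val_mul, inv_pow, h2 _ hI,
    h2 _ hJ, mul_inv_cancel, Units.val_one]

/-- An element of the congruence kernel has a unit in its upper left corner, so it is a product of
lower unipotent, diagonal and upper unipotent elements, each trivial modulo p. -/
theorem coeff_subst_of_map_eq_one (hp3 : 3 ≤ p)
    {g : Matrix.SpecialLinearGroup (Fin 2) (ZMod (p ^ δ))}
    (hg : Matrix.SpecialLinearGroup.map (redHom p δ) g = 1) {I J : ℕ}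
    (hI : p ^ (δ - 1) ∣ I + 1) (hJ : p ^ (δ - 1) ∣ J + 1)
    (P : MvPolynomial (Fin 2) (ZMod (p ^ δ))) :
    coeff (expo I J) (subst g P) = coeff (expo I J) P := by
  have hent : ∀ i j, redHom p δ (g i j) = (1 : Matrix (Fin 2) (Fin 2) (ZMod p)) i j := fun i j => by
    have := congrArg (fun h : Matrix.SpecialLinearGroup (Fin 2) (ZMod p) => h i j) hg
    simpa using this
  have h00 : redHom p δ (g 0 0) = 1 := by rw [hent]; simp
  obtain ⟨a, ha⟩ := (isUnit_iff_redHom_ne_zero (g 0 0)).2 (by rw [h00]; exact one_ne_zero)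
  obtain ⟨b, hb⟩ := (redHom_eq_zero_iff (g 0 1)).1 (by rw [hent]; simp)
  obtain ⟨c, hc⟩ := (redHom_eq_zero_iff (g 1 0)).1 (by rw [hent]; simp)
  rw [eq_lowerUnip_mul g a ha, hb, hc, subst_mul, subst_mul, AlgHom.comp_apply, AlgHom.comp_apply,
    mul_left_comm, mul_left_comm _ _ b, coeff_subst_lowerUnip hp3 _ hI,
    coeff_subst_torus (by rw [ha, h00]) hI hJ, coeff_subst_unip hp3 _ hJ]

/-- A lift of a matrix in `SL₂(ℤ/p)` to `SL₂(ℤ/p^δ)`. -/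
noncomputable def liftSL2 (δ : ℕ) [NeZero δ] (g : Matrix.SpecialLinearGroup (Fin 2) (ZMod p)) :
    Matrix.SpecialLinearGroup (Fin 2) (ZMod (p ^ δ)) := (exists_lift_SL2 g).choose

theorem map_liftSL2 (g : Matrix.SpecialLinearGroup (Fin 2) (ZMod p)) :
    Matrix.SpecialLinearGroup.map (redHom p δ) (liftSL2 δ g) = g := (exists_lift_SL2 g).choose_spec

/-- Averaging of a coefficient functional over `SL₂(ℤ/p)`. -/
noncomputable def sumCoeff (p δ : ℕ) [Fact p.Prime] [NeZero δ] (m : Fin 2 →₀ ℕ) :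
    MvPolynomial (Fin 2) (ZMod (p ^ δ)) →ₗ[ZMod (p ^ δ)] ZMod (p ^ δ) :=
  ∑ g : Matrix.SpecialLinearGroup (Fin 2) (ZMod p),
    (lcoeff (ZMod (p ^ δ)) m).comp (polyRep (ZMod (p ^ δ)) (liftSL2 δ g))

theorem sumCoeff_apply (m : Fin 2 →₀ ℕ) (P : MvPolynomial (Fin 2) (ZMod (p ^ δ))) :
    sumCoeff p δ m P = ∑ g : Matrix.SpecialLinearGroup (Fin 2) (ZMod p),
      coeff m (subst (liftSL2 δ g) P) := by
  rw [sumCoeff, LinearMap.sum_apply]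
  rfl

/-- Right translation by h permutes SL₂(F_p), and two lifts of the same matrix differ by an element
of the congruence kernel, which the coefficient does not see. -/
theorem sumCoeff_subst (hp3 : 3 ≤ p) {I J : ℕ} (hI : p ^ (δ - 1) ∣ I + 1)
    (hJ : p ^ (δ - 1) ∣ J + 1) (h : Matrix.SpecialLinearGroup (Fin 2) (ZMod (p ^ δ)))
    (P : MvPolynomial (Fin 2) (ZMod (p ^ δ))) :
    sumCoeff p δ (expo I J) (subst h P) = sumCoeff p δ (expo I J) P := by
  rw [sumCoeff_apply, sumCoeff_apply]
  refine Fintype.sum_equiv (Equiv.mulRight (Matrix.SpecialLinearGroup.map (redHom p δ) h)) _ _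
    fun g => ?_
  rw [Equiv.coe_mulRight]
  set g' := g * Matrix.SpecialLinearGroup.map (redHom p δ) h with hg'
  have h1 : subst (liftSL2 δ g) (subst h P) =
      subst (liftSL2 δ g * h * (liftSL2 δ g')⁻¹) (subst (liftSL2 δ g') P) := by
    rw [← AlgHom.comp_apply, ← subst_mul, ← AlgHom.comp_apply, ← subst_mul, inv_mul_cancel_right]
  rw [h1]
  refine coeff_subst_of_map_eq_one hp3 ?_ hI hJ _
  rw [map_mul, map_mul, map_inv, map_liftSL2, map_liftSL2, hg', mul_inv_cancel]

theorem sumCoeff_eq_zero (hp3 : 3 ≤ p) {I J : ℕ} (hI : p ^ (δ - 1) ∣ I + 1)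
    (hJ : p ^ (δ - 1) ∣ J + 1) {P : MvPolynomial (Fin 2) (ZMod (p ^ δ))} (hP : cls p δ P = 0) :
    sumCoeff p δ (expo I J) P = 0 := by
  have h := Representation.Coinvariants.lift_mk (polyRep (ZMod (p ^ δ))) (sumCoeff p δ (expo I J))
    (fun g => LinearMap.ext fun Q => sumCoeff_subst hp3 hI hJ g Q) P
  rw [← h]
  change Representation.Coinvariants.lift _ _ _ (cls p δ P) = 0
  rw [hP, map_zero]

theorem redHom_sumCoeff (m : Fin 2 →₀ ℕ) (P : MvPolynomial (Fin 2) (ZMod (p ^ δ))) :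
    redHom p δ (sumCoeff p δ m P) = ∑ g : Matrix.SpecialLinearGroup (Fin 2) (ZMod p),
      coeff m (subst g (red p δ P)) := by
  rw [sumCoeff_apply, map_sum]
  refine Finset.sum_congr rfl fun g _ => ?_
  rw [← coeff_red, red, map_subst, map_liftSL2]

theorem redHom_sumCoeff_eq_zero (hp3 : 3 ≤ p) {I J : ℕ} (hI : p ^ (δ - 1) ∣ I + 1)
    (hJ : p ^ (δ - 1) ∣ J + 1) {P : MvPolynomial (Fin 2) (ZMod (p ^ δ))}
    (hP : P ∈ torsionKer p δ) : redHom p δ (sumCoeff p δ (expo I J) P) = 0 := by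
  rw [mem_torsionKer, ← map_smul] at hP
  have := sumCoeff_eq_zero hp3 hI hJ hP
  rwa [map_smul, smul_eq_mul, pow_mul_eq_zero_iff] at this

end

section

/-! ### The transfer of the top monomial and independence of the Dickson invariants -/

variable {p δ : ℕ}

theorem mem_dicksonRing_iff {a : MvPolynomial (Fin 2) (ZMod (p ^ δ))} :
    a ∈ dicksonRing p δ ↔ ∃ F : MvPolynomial (Fin 2) (ZMod (p ^ δ)), aeval ![f₁ p δ, f₂ p δ] F = a := by
  rw [dicksonRing, ← Matrix.range_cons_cons_empty (f₁ p δ) (f₂ p δ) ![],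
    Algebra.adjoin_range_eq_range_aeval]
  rfl

/-- The constant coefficient as a functional on the coinvariants. -/
noncomputable def constFun (p δ : ℕ) : Coinv p δ →ₗ[ZMod (p ^ δ)] ZMod (p ^ δ) :=
  Representation.Coinvariants.lift (polyRep (ZMod (p ^ δ)))
    (lcoeff (ZMod (p ^ δ)) 0) (fun g => LinearMap.ext fun P => by
      change coeff 0 (subst g P) = coeff 0 P
      have : (aeval (0 : Fin 2 → ZMod (p ^ δ))).comp (subst g) =
          aeval (0 : Fin 2 → ZMod (p ^ δ)) := by
        apply MvPolynomial.algHom_ext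
        intro j
        rw [AlgHom.comp_apply, subst_X]
        simp
      have h := DFunLike.congr_fun this P
      rw [AlgHom.comp_apply] at h
      simpa [aeval_zero, constantCoeff_eq] using h)

theorem constFun_cls (P : MvPolynomial (Fin 2) (ZMod (p ^ δ))) :
    constFun p δ (cls p δ P) = constantCoeff P := rfl

theorem constantCoeff_mul_topMono [NeZero δ] (hp3 : 3 ≤ p) (a : MvPolynomial (Fin 2) (ZMod (p ^ δ))) :
    constantCoeff (a * topMono p δ) = 0 := by
  have : 1 < p ^ δ := Nat.one_lt_pow (NeZero.ne δ) (by omega)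
  rw [topMono, map_mul, map_mul, map_pow (constantCoeff) (X 1), constantCoeff_X,
    zero_pow (by omega), mul_zero, mul_zero]

variable [Fact p.Prime]

/-- By Frobenius the image is (aX^p + cY^p)^(p-1) (bX + dY)^(p-1). The X-exponent pr + s with r, s ≤
p-1 equals p(p-1) only for r = p-1, s = 0. -/
theorem coeff_subst_topMono_mod (g : Matrix.SpecialLinearGroup (Fin 2) (ZMod p)) :
    coeff (expo ((p - 1) * p) (p - 1)) (subst g (X 0 ^ ((p - 1) * p) * X 1 ^ (p - 1))) =
      (g 0 0 * g 1 1) ^ (p - 1) := by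
  have hp := (Fact.out : p.Prime)
  have hp2 := hp.two_le
  have h1 : ∀ x : ZMod p, (C x : MvPolynomial (Fin 2) (ZMod p)) ^ p = C x := fun x => by
    rw [← map_pow, ZMod.pow_card]
  rw [map_mul, map_pow, map_pow, subst_X, subst_X, mul_comm (p - 1) p, pow_mul, add_pow_char,
    mul_pow, mul_pow, h1, h1, add_pow, add_pow, Finset.sum_mul_sum, coeff_sum,
    Finset.sum_eq_single (p - 1), coeff_sum, Finset.sum_eq_single 0]
  · rw [show ((C (g 0 0) * X 0 ^ p) ^ (p - 1) * (C (g 1 0) * X 1 ^ p) ^ (p - 1 - (p - 1)) *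
        (((p - 1).choose (p - 1) : ℕ) : MvPolynomial (Fin 2) (ZMod p)) *
        ((C (g 0 1) * X 0) ^ 0 * (C (g 1 1) * X 1) ^ (p - 1 - 0) * (((p - 1).choose 0 : ℕ) :
        MvPolynomial (Fin 2) (ZMod p)))) = C ((g 0 0 * g 1 1) ^ (p - 1)) *
        (X 0 ^ (p * (p - 1)) * X 1 ^ (p - 1)) by
      simp only [Nat.sub_self, pow_zero, Nat.choose_self, Nat.choose_zero_right, Nat.sub_zero,
        Nat.cast_one, mul_one, one_mul, mul_pow, map_mul, map_pow, ← pow_mul]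
      ring,
      coeff_C_mul_X_pow_mul_X_pow, if_pos ⟨rfl, rfl⟩]
  · intro s hs hs0
    have hs := Finset.mem_range.1 hs
    rw [show ((C (g 0 0) * X 0 ^ p) ^ (p - 1) * (C (g 1 0) * X 1 ^ p) ^ (p - 1 - (p - 1)) *
        (((p - 1).choose (p - 1) : ℕ) : MvPolynomial (Fin 2) (ZMod p)) *
        ((C (g 0 1) * X 0) ^ s * (C (g 1 1) * X 1) ^ (p - 1 - s) * (((p - 1).choose s : ℕ) :
        MvPolynomial (Fin 2) (ZMod p)))) = C (g 0 0 ^ (p - 1) * g 0 1 ^ s *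
          g 1 1 ^ (p - 1 - s) * ((p - 1).choose s : ℕ)) *
        (X 0 ^ (p * (p - 1) + s) * X 1 ^ (p - 1 - s)) by
      simp only [Nat.sub_self, pow_zero, Nat.choose_self, Nat.cast_one, mul_one, mul_pow, map_mul,
        map_pow, ← pow_mul, pow_add, map_natCast]
      ring,
      coeff_C_mul_X_pow_mul_X_pow, if_neg (by omega)]
  · intro h
    exact absurd (Finset.mem_range.2 (by omega)) h
  · intro r hr hrp
    have hr := Finset.mem_range.1 hr
    rw [coeff_sum]
    refine Finset.sum_eq_zero fun s hs => ?_
    have hs := Finset.mem_range.1 hs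
    rw [show ((C (g 0 0) * X 0 ^ p) ^ r * (C (g 1 0) * X 1 ^ p) ^ (p - 1 - r) *
        (((p - 1).choose r : ℕ) : MvPolynomial (Fin 2) (ZMod p)) *
        ((C (g 0 1) * X 0) ^ s * (C (g 1 1) * X 1) ^ (p - 1 - s) * (((p - 1).choose s : ℕ) :
        MvPolynomial (Fin 2) (ZMod p)))) = C (g 0 0 ^ r * g 1 0 ^ (p - 1 - r) *
          ((p - 1).choose r : ℕ) * (g 0 1 ^ s * g 1 1 ^ (p - 1 - s) * ((p - 1).choose s : ℕ))) *
        (X 0 ^ (p * r + s) * X 1 ^ (p * (p - 1 - r) + (p - 1 - s))) by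
      simp only [mul_pow, map_mul, map_pow, ← pow_mul, pow_add, map_natCast]
      ring,
      coeff_C_mul_X_pow_mul_X_pow, if_neg]
    rintro ⟨h, -⟩
    have : p * (r + 1) ≤ p * (p - 1) := Nat.mul_le_mul_left p (by omega)
    rw [mul_add, mul_one] at this
    omega
  · intro h
    exact absurd (Finset.mem_range.2 (by omega)) h

theorem sum_ite_eq_zero_else (e : ZMod p) : ∑ x : ZMod p, (if x = 0 then 0 else e) = -e := by
  have h : ∀ x : ZMod p, (if x = 0 then 0 else e) = e - if x = 0 then e else 0 := fun x => by
    split_ifs <;> simp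
  rw [Finset.sum_congr rfl fun x _ => h x, Finset.sum_sub_distrib, Finset.sum_const,
    Finset.sum_ite_eq', if_pos (Finset.mem_univ _), Finset.card_univ, ZMod.card, nsmul_eq_mul,
    CharP.cast_eq_zero, zero_mul, zero_sub]

theorem sum_pow_sub_one : ∑ x : ZMod p, x ^ (p - 1) = -1 := by
  have hp2 := (Fact.out : p.Prime).two_le
  rw [← sum_ite_eq_zero_else]
  refine Finset.sum_congr rfl fun x _ => ?_
  split_ifs with h
  · rw [h, zero_pow (by omega)]
  · exact ZMod.pow_card_sub_one_eq_one h

theorem sum_one_add_mul_pow (b : ZMod p) :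
    ∑ c : ZMod p, (1 + b * c) ^ (p - 1) = if b = 0 then 0 else -1 := by
  split_ifs with h
  · simp [h]
  · rw [← sum_pow_sub_one]
    exact Fintype.sum_equiv ((Equiv.mulLeft₀ b h).trans (Equiv.addLeft 1)) _ _ fun x => rfl

/-- Matrices with a = 0 contribute nothing; the others are parametrized by (a, b, c) with ad = 1 +
bc. The sum over c is -1 for b ≠ 0 and 0 for b = 0, so b and c together give 1, and a has p-1
values. -/
theorem sum_SL2_eq : ∑ g : Matrix.SpecialLinearGroup (Fin 2) (ZMod p),
    (g 0 0 * g 1 1) ^ (p - 1) = -1 := by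
  classical
  have hp2 := (Fact.out : p.Prime).two_le
  have h1 : ∑ x : (ZMod p)ˣ × ZMod p × ZMod p, (1 + x.2.1 * x.2.2) ^ (p - 1) =
      ∑ g : Matrix.SpecialLinearGroup (Fin 2) (ZMod p), (g 0 0 * g 1 1) ^ (p - 1) := by
    refine Finset.sum_of_injOn (fun x => ⟨!![(x.1 : ZMod p), x.2.1; x.2.2,
      (1 + x.2.1 * x.2.2) * ↑x.1⁻¹], by
        rw [Matrix.det_fin_two_of]
        linear_combination (1 + x.2.1 * x.2.2) * Units.mul_inv x.1⟩) ?_ ?_ ?_ ?_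
    · rintro ⟨a, b, c⟩ - ⟨a', b', c'⟩ - h
      have hM := congrArg Subtype.val h
      have h00 : (a : ZMod p) = a' := congrFun (congrFun hM 0) 0
      have h01 : b = b' := congrFun (congrFun hM 0) 1
      have h10 : c = c' := congrFun (congrFun hM 1) 0
      rw [Units.ext h00, h01, h10]
    · intro x _
      exact Finset.mem_coe.2 (Finset.mem_univ _)
    · intro g _ hg
      have h0 : g 0 0 = 0 := by
        by_contra h
        refine hg ⟨⟨Units.mk0 _ h, g 0 1, g 1 0⟩, by simp, ?_⟩
        have hdet := SL2_det g
        refine SL2_ext rfl rfl rfl ?_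
        change (1 + g 0 1 * g 1 0) * (g 0 0)⁻¹ = g 1 1
        rw [mul_inv_eq_iff_eq_mul₀ h]
        linear_combination -hdet
      rw [h0, zero_mul, zero_pow (by omega)]
    · rintro ⟨a, b, c⟩ -
      change _ = ((a : ZMod p) * ((1 + b * c) * ↑a⁻¹)) ^ (p - 1)
      rw [mul_left_comm, Units.mul_inv, mul_one]
  rw [← h1, Fintype.sum_prod_type]
  simp only [Fintype.sum_prod_type, sum_one_add_mul_pow, sum_ite_eq_zero_else]
  rw [Finset.sum_const, Finset.card_univ, ZMod.card_units_eq_totient,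
    Nat.totient_prime (Fact.out : p.Prime), nsmul_eq_mul, Nat.cast_sub (by omega),
    CharP.cast_eq_zero]
  simp

theorem sum_subst_topMono_mod_ne_zero : ∑ g : Matrix.SpecialLinearGroup (Fin 2) (ZMod p),
    subst g (X 0 ^ ((p - 1) * p) * X 1 ^ (p - 1)) ≠ 0 := by
  intro h
  have := congrArg (coeff (expo ((p - 1) * p) (p - 1))) h
  rw [coeff_sum, Finset.sum_congr rfl fun g _ => coeff_subst_topMono_mod g, sum_SL2_eq,
    coeff_zero] at this
  exact one_ne_zero (neg_eq_zero.1 this)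

theorem subst_dickson₁ (g : Matrix.SpecialLinearGroup (Fin 2) (ZMod p)) :
    subst g (dickson₁ (ZMod p) p) = dickson₁ (ZMod p) p := by
  have := map_subst_dickson₁ (RingHom.id (ZMod p)) g
  rwa [MvPolynomial.map_id] at this

theorem subst_dickson₂ (g : Matrix.SpecialLinearGroup (Fin 2) (ZMod p)) :
    subst g (dickson₂ (ZMod p) p) = dickson₂ (ZMod p) p := by
  have := map_subst_dickson₂ (RingHom.id (ZMod p)) g
  rwa [MvPolynomial.map_id] at this

/-- Divide a relation by the largest common power of d₁ and set Y = 0: then d₁ becomes 0 and d₂ a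
positive power of X, so a coefficient of minimal d₁-degree would vanish. -/
theorem aeval_dickson_injective {F : MvPolynomial (Fin 2) (ZMod p)}
    (hF : aeval ![dickson₁ (ZMod p) p, dickson₂ (ZMod p) p] F = 0) : F = 0 := by
  have hp2 := (Fact.out : p.Prime).two_le
  by_contra hne
  obtain ⟨n, hn, hmin⟩ := Finset.exists_min_image F.support (fun m => m 0)
    (support_nonempty.2 hne)
  set D₁ := dickson₁ (ZMod p) p with hD₁
  set D₂ := dickson₂ (ZMod p) p with hD₂
  have h1 : D₁ ^ n 0 * ∑ m ∈ F.support, C (coeff m F) * (D₁ ^ (m 0 - n 0) * D₂ ^ m 1) = 0 := by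
    rw [← hF, aeval_def, eval₂_eq', Finset.mul_sum]
    refine Finset.sum_congr rfl fun m hm => ?_
    rw [Fin.prod_univ_two, algebraMap_eq, show ![D₁, D₂] 0 = D₁ from rfl,
      show ![D₁, D₂] 1 = D₂ from rfl]
    conv_rhs => rw [← Nat.add_sub_of_le (hmin m hm), pow_add]
    ring
  have h2 := (mul_eq_zero.1 h1).resolve_left (pow_ne_zero _ (dickson₁_ne_zero p))
  have h3 := congrArg (aeval (![Polynomial.X, 0] : Fin 2 → Polynomial (ZMod p))) h2
  have e1 : aeval (![Polynomial.X, 0] : Fin 2 → Polynomial (ZMod p)) D₁ = 0 := by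
    simp [hD₁, dickson₁, show p ≠ 0 by omega]
  have e2 : aeval (![Polynomial.X, 0] : Fin 2 → Polynomial (ZMod p)) D₂ =
      Polynomial.X ^ ((p - 1) * p) := by
    rw [hD₂, dickson₂, map_sum, Finset.sum_range_succ, Finset.sum_eq_zero]
    · simp [pow_mul]
    · intro i hi
      have hi := Finset.mem_range.1 hi
      simp [show p - 1 ≠ 0 by omega, show p - i ≠ 0 by omega]
  rw [map_sum, map_zero (aeval (![Polynomial.X, 0] : Fin 2 → Polynomial (ZMod p)))] at h3
  simp only [map_mul, map_pow, e1, e2, algHom_C, Polynomial.algebraMap_eq] at h3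
  have h4 := congrArg (fun P => Polynomial.coeff P ((p - 1) * p * n 1)) h3
  simp only [Polynomial.finsetSum_coeff, Polynomial.coeff_zero, ← pow_mul] at h4
  rw [Finset.sum_eq_single_of_mem n hn] at h4
  · simp only [Nat.sub_self, pow_zero, one_mul, Polynomial.coeff_C_mul_X_pow, if_true] at h4
    exact mem_support_iff.1 hn h4
  · intro m hm hmn
    rcases (hmin m hm).eq_or_lt with h | h
    · rw [h, Nat.sub_self, pow_zero, one_mul, Polynomial.coeff_C_mul_X_pow, if_neg]
      intro h'
      apply hmn
      have h5 : n 1 = m 1 := Nat.eq_of_mul_eq_mul_left (Nat.mul_pos (by omega) (by omega)) h'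
      rw [← expo_self m, ← expo_self n, h, h5]
    · rw [zero_pow (by omega), zero_mul, mul_zero, Polynomial.coeff_zero]

variable [NeZero δ]

theorem red_aeval (F : MvPolynomial (Fin 2) (ZMod (p ^ δ))) :
    red p δ (aeval ![f₁ p δ, f₂ p δ] F) =
      aeval ![dickson₁ (ZMod p) p, dickson₂ (ZMod p) p] (red p δ F) ^ p ^ (δ - 1) := by
  induction F using MvPolynomial.induction_on with
  | C a => rw [algHom_C, algebraMap_eq, red_C, algHom_C, algebraMap_eq, ← map_pow, ZMod.pow_card_pow]
  | add P Q hP hQ => rw [map_add, map_add, hP, hQ, map_add, map_add, add_pow_char_pow]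
  | mul_X P i hP =>
    rw [map_mul, map_mul, hP, map_mul, map_mul, mul_pow, red_X, aeval_X, aeval_X]
    congr 1
    fin_cases i
    · exact red_f₁
    · exact red_f₂

/-- The functionals read off all coefficients of the trace of G·X^(p²-p) Y^(p-1), where G = F(d₁,
d₂) modulo p. As G is invariant it factors out, and the remaining trace is nonzero in a domain. -/
theorem red_eq_zero_of_mem_torsionKer (hp3 : 3 ≤ p) {F : MvPolynomial (Fin 2) (ZMod (p ^ δ))}
    (hF : aeval ![f₁ p δ, f₂ p δ] F * topMono p δ ∈ torsionKer p δ) : red p δ F = 0 := by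
  have hq : 1 ≤ p ^ (δ - 1) := Nat.one_le_pow _ _ (Fact.out : p.Prime).pos
  apply aeval_dickson_injective
  set G := aeval ![dickson₁ (ZMod p) p, dickson₂ (ZMod p) p] (red p δ F) with hG
  have hGinv : ∀ g : Matrix.SpecialLinearGroup (Fin 2) (ZMod p), subst g G = G := by
    intro g
    rw [hG, ← AlgHom.comp_apply, comp_aeval]
    congr 2
    funext i
    fin_cases i
    · exact subst_dickson₁ g
    · exact subst_dickson₂ g
  have hred : red p δ (aeval ![f₁ p δ, f₂ p δ] F * topMono p δ) =
      frobTwist p δ (G * (X 0 ^ ((p - 1) * p) * X 1 ^ (p - 1))) := by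
    rw [map_mul, red_aeval, red_topMono, frobTwist_apply, frobTwist_apply, mul_pow G]
    ring
  have h1 : G * ∑ g : Matrix.SpecialLinearGroup (Fin 2) (ZMod p),
      subst g (X 0 ^ ((p - 1) * p) * X 1 ^ (p - 1)) = 0 := by
    ext m
    rw [Finset.mul_sum, coeff_sum, coeff_zero, ← expo_self m]
    have h2 := redHom_sumCoeff_eq_zero hp3 (I := p ^ (δ - 1) - 1 + m 0 * p ^ (δ - 1))
      (J := p ^ (δ - 1) - 1 + m 1 * p ^ (δ - 1)) ⟨m 0 + 1, by rw [mul_add, mul_comm]; omega⟩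
      ⟨m 1 + 1, by rw [mul_add, mul_comm]; omega⟩ hF
    rw [redHom_sumCoeff, hred] at h2
    rw [← h2]
    refine Finset.sum_congr rfl fun g _ => ?_
    rw [coeff_subst_frobTwist hp3, map_mul (subst g) G, hGinv]
  exact (mul_eq_zero.1 h1).resolve_right sum_subst_topMono_mod_ne_zero

/-- If F = p^e F' with e < δ, multiplying the relation by p^(δ-1-e) shows that p^(δ-1) kills the
class attached to F', so p divides F' as well. At e = δ this forces F = 0. -/
theorem eq_zero_of_cls_aeval_eq_zero (hp3 : 3 ≤ p) {F : MvPolynomial (Fin 2) (ZMod (p ^ δ))}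
    (hF : cls p δ (aeval ![f₁ p δ, f₂ p δ] F * topMono p δ) = 0) : F = 0 := by
  have key : ∀ e ≤ δ, (p : MvPolynomial (Fin 2) (ZMod (p ^ δ))) ^ e ∣ F := by
    intro e
    induction e with
    | zero => intro _; rw [pow_zero]; exact one_dvd F
    | succ e ih =>
      intro he
      obtain ⟨F', rfl⟩ := ih (by omega)
      rw [pow_succ]
      refine mul_dvd_mul_left _ ((red_eq_zero_iff F').1 (red_eq_zero_of_mem_torsionKer hp3 ?_))
      rw [map_mul (aeval ![f₁ p δ, f₂ p δ]), map_pow, map_natCast, mul_assoc] at hF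
      rw [mem_torsionKer, show δ - 1 = (δ - 1 - e) + e by omega, pow_add, mul_smul,
        ← map_smul (cls p δ) ((p : ZMod (p ^ δ)) ^ e), smul_eq_C_mul, map_pow, map_natCast, hF,
        smul_zero]
  obtain ⟨G, hG⟩ := key δ le_rfl
  rw [hG, poly_natCast_pow_eq_zero, zero_mul]

end

section

/-! ### Freeness and primitivity -/

theorem exists_basis_span_singleton {A M : Type*} [CommRing A] [AddCommGroup M] [Module A M]
    (x : M) (h : ∀ a : A, a • x = 0 → a = 0) :
    ∃ b : Module.Basis (Fin 1) A (Submodule.span A {x}), (b 0 : M) = x := by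
  let f : A →ₗ[A] Submodule.span A {x} :=
    LinearMap.toSpanSingleton A _ ⟨x, Submodule.mem_span_singleton_self x⟩
  have hf : ∀ a, (f a : M) = a • x := fun a => rfl
  have hbij : Function.Bijective f := by
    constructor
    · rw [← LinearMap.ker_eq_bot, LinearMap.ker_eq_bot']
      intro a ha
      exact h a (by rw [← hf, ha]; rfl)
    · rintro ⟨y, hy⟩
      obtain ⟨a, rfl⟩ := Submodule.mem_span_singleton.1 hy
      exact ⟨a, rfl⟩
  refine ⟨(Module.Basis.singleton (Fin 1) A).map (LinearEquiv.ofBijective f hbij), ?_⟩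
  rw [Module.Basis.map_apply, Module.Basis.singleton_apply, LinearEquiv.ofBijective_apply, hf,
    one_smul]

variable {p δ : ℕ}

theorem natCast_pow_smul {M : Type*} [AddCommGroup M] [Module (ZMod (p ^ δ)) M] (n : ℕ) (x : M) :
    (p : ZMod (p ^ δ)) ^ n • x = p ^ n • x := by
  rw [← Nat.cast_pow, Nat.cast_smul_eq_nsmul]

theorem cls_C (r : ZMod (p ^ δ)) : cls p δ (C r) = r • cls p δ 1 := by
  rw [← map_smul, smul_eq_C_mul, mul_one]

theorem smul_topClass [Fact p.Prime] (a : dicksonRing p δ) :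
    a • topClass p δ = cls p δ ((a : MvPolynomial (Fin 2) (ZMod (p ^ δ))) * topMono p δ) := rfl

/-- The parametrization of `N ⊕ R·1` by `R[s, t] × R`. -/
noncomputable def sumParam (p δ : ℕ) :
    (MvPolynomial (Fin 2) (ZMod (p ^ δ)) × ZMod (p ^ δ)) →ₗ[ZMod (p ^ δ)] Coinv p δ :=
  ((cls p δ).comp ((LinearMap.mulRight (ZMod (p ^ δ)) (topMono p δ)).comp
    (aeval ![f₁ p δ, f₂ p δ]).toLinearMap)).coprod (LinearMap.toSpanSingleton _ _ (cls p δ 1))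

theorem sumParam_apply (F : MvPolynomial (Fin 2) (ZMod (p ^ δ))) (r : ZMod (p ^ δ)) :
    sumParam p δ (F, r) =
      cls p δ (aeval ![f₁ p δ, f₂ p δ] F * topMono p δ) + r • cls p δ 1 := rfl

theorem eq_zero_of_smul_cls_one (r : ZMod (p ^ δ)) (hr : r • cls p δ 1 = 0) : r = 0 := by
  rw [← cls_C] at hr
  simpa [constFun_cls] using congrArg (constFun p δ) hr

theorem range_sumParam [Fact p.Prime] : LinearMap.range (sumParam p δ) =
    (topModule p δ).restrictScalars (ZMod (p ^ δ)) ⊔ oneModule p δ := by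
  apply le_antisymm
  · rintro _ ⟨⟨F, r⟩, rfl⟩
    rw [sumParam_apply]
    refine Submodule.add_mem_sup ?_ (Submodule.smul_mem _ _ (Submodule.mem_span_singleton_self _))
    exact (topModule p δ).smul_mem
      (⟨aeval ![f₁ p δ, f₂ p δ] F, mem_dicksonRing_iff.2 ⟨F, rfl⟩⟩ : dicksonRing p δ)
      (Submodule.mem_span_singleton_self _)
  · refine sup_le (fun x hx => ?_) ?_
    · obtain ⟨a, rfl⟩ := Submodule.mem_span_singleton.1 (show x ∈ topModule p δ from hx)
      obtain ⟨F, hF⟩ := mem_dicksonRing_iff.1 a.2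
      exact ⟨(F, 0), by rw [sumParam_apply, hF, zero_smul, add_zero, smul_topClass]⟩
    · refine (Submodule.span_singleton_le_iff_mem _ _).2 ⟨(0, 1), ?_⟩
      rw [sumParam_apply, map_zero, zero_mul, map_zero, zero_add, one_smul]

variable [Fact p.Prime] [NeZero δ]

/-- In coordinates this is the fact that the annihilator of p^(δ-1) in ℤ/p^δ is the ideal (p). -/
theorem exists_eq_smul_of_pow_smul_eq_zero {M : Type*} [AddCommGroup M] [Module (ZMod (p ^ δ)) M]
    [Module.Free (ZMod (p ^ δ)) M] {x : M} (hx : (p : ZMod (p ^ δ)) ^ (δ - 1) • x = 0) :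
    ∃ y : M, x = (p : ZMod (p ^ δ)) • y := by
  have hd : ∀ r : ZMod (p ^ δ), ∃ s, (p : ZMod (p ^ δ)) ^ (δ - 1) * r = 0 → r = p * s := by
    intro r
    by_cases h : (p : ZMod (p ^ δ)) ^ (δ - 1) * r = 0
    · obtain ⟨s, hs⟩ := (redHom_eq_zero_iff r).1 ((pow_mul_eq_zero_iff r).1 h)
      exact ⟨s, fun _ => hs⟩
    · exact ⟨0, fun h' => absurd h' h⟩
  choose d hd using hd
  let b := Module.Free.chooseBasis (ZMod (p ^ δ)) M
  refine ⟨b.repr.symm ((b.repr x).sum fun i r => Finsupp.single i (d r)), ?_⟩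
  apply b.repr.injective
  rw [map_smul, LinearEquiv.apply_symm_apply]
  conv_lhs => rw [← (b.repr x).sum_single]
  rw [Finsupp.sum, Finsupp.sum, Finset.smul_sum]
  refine Finset.sum_congr rfl fun i _ => ?_
  rw [Finsupp.smul_single, smul_eq_mul, ← hd]
  have := DFunLike.congr_fun (congrArg b.repr hx) i
  simpa using this

/-- For y in a free W' ⊇ W, the difference y - f' is killed by p^(δ-1), hence lies in pW'. So W' = W
+ pW', and iterating δ times gives W' = W since p^δ = 0. -/
theorem isPrimitiveSubmodule_of_torsion {M : Type*} [AddCommGroup M] [Module (ZMod (p ^ δ)) M]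
    (W : Submodule (ZMod (p ^ δ)) M) (hW : Module.Free (ZMod (p ^ δ)) W)
    (h : ∀ x : M, ∃ f ∈ W, (p : ZMod (p ^ δ)) ^ (δ - 1) • (x - f) = 0) :
    IsPrimitiveSubmodule W := by
  refine ⟨hW, fun W' hW' hle => ?_⟩
  have hfree : Module.Free (ZMod (p ^ δ)) W' := hW'
  have key : ∀ n : ℕ, ∀ x ∈ W', ∃ f ∈ W, ∃ y ∈ W', x = f + (p : ZMod (p ^ δ)) ^ n • y := by
    intro n
    induction n with
    | zero => exact fun x hx => ⟨0, W.zero_mem, x, hx, by rw [pow_zero, one_smul, zero_add]⟩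
    | succ n ih =>
      intro x hx
      obtain ⟨f, hf, y, hy, rfl⟩ := ih x hx
      obtain ⟨f', hf', hyf⟩ := h y
      obtain ⟨⟨z, hz⟩, hyz⟩ := exists_eq_smul_of_pow_smul_eq_zero (p := p) (δ := δ)
        (x := (⟨y - f', W'.sub_mem hy (hle hf')⟩ : W')) (Subtype.ext hyf)
      have hyz' : y - f' = (p : ZMod (p ^ δ)) • z := congrArg Subtype.val hyz
      refine ⟨f + (p : ZMod (p ^ δ)) ^ n • f', W.add_mem hf (W.smul_mem _ hf'), z, hz, ?_⟩
      rw [pow_succ, mul_smul, ← hyz', smul_sub]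
      abel
  intro x hx
  obtain ⟨f, hf, y, -, rfl⟩ := key δ x hx
  rwa [natCast_pow_eq_zero, zero_smul, add_zero]

theorem eq_zero_of_smul_topClass (hp3 : 3 ≤ p) (a : dicksonRing p δ)
    (ha : a • topClass p δ = 0) : a = 0 := by
  obtain ⟨F, hF⟩ := mem_dicksonRing_iff.1 a.2
  rw [smul_topClass, ← hF] at ha
  apply Subtype.ext
  rw [← hF, eq_zero_of_cls_aeval_eq_zero hp3 ha, map_zero]
  rfl

theorem disjoint_topModule_oneModule (hp3 : 3 ≤ p) :
    Disjoint ((topModule p δ).restrictScalars (ZMod (p ^ δ))) (oneModule p δ) := by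
  rw [Submodule.disjoint_def]
  intro x hx hx'
  obtain ⟨a, rfl⟩ := Submodule.mem_span_singleton.1 (show x ∈ topModule p δ from hx)
  obtain ⟨r, hr⟩ := Submodule.mem_span_singleton.1 hx'
  have h := congrArg (constFun p δ) hr
  rw [← cls_C, constFun_cls, constantCoeff_C, smul_topClass, constFun_cls,
    constantCoeff_mul_topMono hp3] at h
  rw [← hr, h, zero_smul]

/-- The constant term kills every multiple of U and recovers the coefficient of 1; what is left is
the freeness of A·U. -/
theorem sumParam_injective (hp3 : 3 ≤ p) : Function.Injective (sumParam p δ) := by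
  rw [← LinearMap.ker_eq_bot, LinearMap.ker_eq_bot']
  rintro ⟨F, r⟩ h
  rw [sumParam_apply] at h
  have hr : r = 0 := by
    have := congrArg (constFun p δ) h
    rwa [map_add, constFun_cls, constantCoeff_mul_topMono hp3, zero_add, ← cls_C, constFun_cls,
      constantCoeff_C, map_zero] at this
  rw [hr, zero_smul, add_zero] at h
  rw [hr, eq_zero_of_cls_aeval_eq_zero hp3 h]
  rfl

theorem free_sum (hp3 : 3 ≤ p) : Module.Free (ZMod (p ^ δ))
    ((topModule p δ).restrictScalars (ZMod (p ^ δ)) ⊔ oneModule p δ : Submodule _ (Coinv p δ)) := by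
  rw [← range_sumParam]
  exact Module.Free.of_equiv (LinearEquiv.ofInjective _ (sumParam_injective hp3))

theorem exists_topModule_add (hδ : 2 ≤ δ) (hp3 : 3 ≤ p)
    (P : MvPolynomial (Fin 2) (ZMod (p ^ δ))) :
    ∃ f ∈ topModule p δ, (p : ZMod (p ^ δ)) ^ (δ - 1) •
      (cls p δ P - (f + constantCoeff P • cls p δ 1)) = 0 := by
  obtain ⟨a, ha, h⟩ := exists_sub_mem_torsionKer hδ hp3 P
  refine ⟨(⟨a, ha⟩ : dicksonRing p δ) • topClass p δ,
    Submodule.smul_mem _ _ (Submodule.mem_span_singleton_self _), ?_⟩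
  rw [mem_torsionKer, map_sub, map_sub, cls_C] at h
  rw [smul_topClass, ← h]
  congr 1
  abel

theorem exists_sum_add (hδ : 2 ≤ δ) (hp3 : 3 ≤ p) (x : Coinv p δ) :
    ∃ f ∈ (topModule p δ).restrictScalars (ZMod (p ^ δ)) ⊔ oneModule p δ,
      (p : ZMod (p ^ δ)) ^ (δ - 1) • (x - f) = 0 := by
  obtain ⟨P, rfl⟩ := Representation.Coinvariants.mk_surjective (polyRep (ZMod (p ^ δ))) x
  obtain ⟨f, hf, h⟩ := exists_topModule_add hδ hp3 P
  exact ⟨_, Submodule.add_mem_sup hf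
    (Submodule.smul_mem _ _ (Submodule.mem_span_singleton_self _)), h⟩

end

end SL2Coinv

theorem mainTheorem4 (p δ : ℕ) [Fact p.Prime] (hp : 3 < p) (hδ : 1 ≤ δ) :
    -- the submodule generated by the class is free of rank one, with that class as a basis
    (∃ b : Module.Basis (Fin 1) (SL2Coinv.dicksonRing p δ) (SL2Coinv.topModule p δ),
      (b 0 : SL2Coinv.Coinv p δ) = SL2Coinv.topClass p δ) ∧
    -- the class of `1` generates a copy of `ℤ/p^δ`, and the sum of the two is direct
    (∃ b : Module.Basis (Fin 1) (ZMod (p ^ δ)) (SL2Coinv.oneModule p δ),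
      (b 0 : SL2Coinv.Coinv p δ) = SL2Coinv.cls p δ 1) ∧
    Disjoint ((SL2Coinv.topModule p δ).restrictScalars (ZMod (p ^ δ))) (SL2Coinv.oneModule p δ) ∧
    (2 ≤ δ →
      -- the direct sum is a primitive submodule
      SL2Coinv.IsPrimitiveSubmodule
        ((SL2Coinv.topModule p δ).restrictScalars (ZMod (p ^ δ)) ⊔ SL2Coinv.oneModule p δ) ∧
      -- elements of order `p^δ`
      (∀ x : SL2Coinv.Coinv p δ, addOrderOf x = p ^ δ →
        ∃ (c : (ZMod (p ^ δ))ˣ) (f h : SL2Coinv.Coinv p δ),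
          f ∈ (SL2Coinv.topModule p δ).restrictScalars (ZMod (p ^ δ)) ⊔ SL2Coinv.oneModule p δ ∧
          p ^ (δ - 1) • h = 0 ∧ x = (c : ZMod (p ^ δ)) • f + h) ∧
      -- elements of order `p^δ` without a component in degree zero
      (∀ P : MvPolynomial (Fin 2) (ZMod (p ^ δ)), MvPolynomial.constantCoeff P = 0 →
        addOrderOf (SL2Coinv.cls p δ P) = p ^ δ →
        ∃ (c : (ZMod (p ^ δ))ˣ) (f h : SL2Coinv.Coinv p δ),
          f ∈ SL2Coinv.topModule p δ ∧
          p ^ (δ - 1) • h = 0 ∧ SL2Coinv.cls p δ P = (c : ZMod (p ^ δ)) • f + h)) := by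
  have : NeZero δ := ⟨by omega⟩
  have hp3 : 3 ≤ p := hp.le
  refine ⟨SL2Coinv.exists_basis_span_singleton _ (SL2Coinv.eq_zero_of_smul_topClass hp3),
    SL2Coinv.exists_basis_span_singleton _ SL2Coinv.eq_zero_of_smul_cls_one,
    SL2Coinv.disjoint_topModule_oneModule hp3, fun hδ2 =>
      ⟨SL2Coinv.isPrimitiveSubmodule_of_torsion _ (SL2Coinv.free_sum hp3)
        (SL2Coinv.exists_sum_add hδ2 hp3), fun x _ => ?_, fun P hP _ => ?_⟩⟩
  · obtain ⟨f, hf, h⟩ := SL2Coinv.exists_sum_add hδ2 hp3 x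
    -- The unit is 1: the difference x - f is itself killed by p^(δ-1).
    refine ⟨1, f, x - f, hf, ?_, ?_⟩
    · rw [← SL2Coinv.natCast_pow_smul (δ := δ), h]
    · rw [Units.val_one, one_smul, add_sub_cancel]
  · obtain ⟨f, hf, h⟩ := SL2Coinv.exists_topModule_add hδ2 hp3 P
    rw [hP, zero_smul, add_zero] at h
    refine ⟨1, f, SL2Coinv.cls p δ P - f, hf, ?_, ?_⟩
    · rw [← SL2Coinv.natCast_pow_smul (δ := δ), h]
    · rw [Units.val_one, one_smul, add_sub_cancel]
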